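/- Consider single-item first-price auctions with $n$ bidders, for arbitrary $n$. The value profile $\mathbf v=(v_1,\dots,v_n)\in[0,\infty)^n$ is drawn from an arbitrary joint distribution $\mathbf V$ (values may be correlated) with $0<\mathsf{OPT}(\mathbf V):=\mathbb E[\max_i v_i]<\infty$. Bidder $i$ observes only $v_i$ and submits a bid drawn from $s_i(v_i)$, a probability distribution on $[0,\infty)$ depending measurably on $v_i$; given $\mathbf v$, the bids are independent. The item goes to a highest bidder, who pays her own bid; ties are broken by a (randomized, measurable) rule that depends only on the bid profile, and an auction $\mathcal A$ is identified with its tie-breaking rule. For a bidder $i$ with value $v$ and bid $b$, let $u_i(v,b)=(v-b)\cdot\Pr[\,i\text{ wins with bid }b\mid v_i=v\,]$, where the other bidders follow $\mathbf s$. A strategy profile $\mathbf s=(s_i)_i$ is a Bayesian Nash Equilibrium, $\mathbf s\in\mathbb{BNE}(\mathbf V,\mathcal A)$, if for every bidder $i$ and almost every value $v$ of hers, $\mathbb E_{b\sim s_i(v)}[u_i(v,b)]\ge u_i(v,b^*)$ for all $b^*\ge 0$. Let $\mathsf{FPA}(\mathbf V,\mathcal A,\mathbf s)$ be the expected value of the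 winner. Then the Price of Stability over Bayesian Nash Equilibria for correlated valuations is exactly $1-1/e$: $$\mathsf{PoS}=\inf_{(\mathbf V,\mathcal A)\,:\ \mathbb{BNE}(\mathbf V,\mathcal A)\neq\emptyset}\ \ \sup_{\mathbf s\in\mathbb{BNE}(\mathbf V,\mathcal A)}\frac{\mathsf{FPA}(\mathbf V,\mathcal A,\mathbf s)}{\mathsf{OPT}(\mathbf V)}=1-\frac1e ,$$ where the infimum also ranges over $n$. The value is the same if the tie-breaking rule is not part of the instance but is selected together with the equilibrium: $$\inf_{\mathbf V\,:\ \exists\mathcal A,\ \mathbb{BNE}(\mathbf V,\mathcal A)\neq\emptyset}\ \ \sup_{\mathcal A,\ \mathbf s\in\mathbb{BNE}(\mathbf V,\mathcal A)}\frac{\mathsf{FPA}(\mathbf V,\mathcal A,\mathbf s)}{\mathsf{OPT}(\mathbf V)}=1-\frac1e .$$ -/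

import Mathlib

open MeasureTheory ProbabilityTheory
open scoped NNReal ENNReal

noncomputable section

/-- A first-price auction with `n` bidders, given by its (randomized) allocation rule:
`alloc b i` is the probability that bidder `i` gets the item under the bid profile `b`.
The item always goes to a highest bidder; ties are broken by an arbitrary (randomized) rule
depending on the bid profile. The winner pays her own bid. -/
structure FirstPriceAuction (n : ℕ) where
  alloc : (Fin n → ℝ≥0) → Fin n → ℝ≥0
  measurable_alloc : ∀ i, Measurable fun b => alloc b i
  sum_alloc : ∀ b, ∑ i, alloc b i = 1
  highest_of_alloc_ne_zero : ∀ b i, alloc b i ≠ 0 → ∀ j, b j ≤ b i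

/-- A (randomized) strategy profile: `s.bid i v` is the law of the bid of bidder `i` when her
value is `v`. Bidders randomize independently of each other. -/
structure StrategyProfile (n : ℕ) where
  bid : Fin n → Kernel ℝ≥0 ℝ≥0
  isMarkovKernel_bid : ∀ i, IsMarkovKernel (bid i)

instance {n : ℕ} (s : StrategyProfile n) (i : Fin n) : IsMarkovKernel (s.bid i) :=
  s.isMarkovKernel_bid i

namespace StrategyProfile

/-- The law of the bid profile when the value profile is `w`. -/
def bidLaw {n : ℕ} (s : StrategyProfile n) (w : Fin n → ℝ≥0) : Measure (Fin n → ℝ≥0) :=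
  Measure.pi fun i => s.bid i (w i)

end StrategyProfile

namespace FirstPriceAuction

variable {n : ℕ}

/-- The probability that bidder `i` wins with the bid `b`, conditionally on her value being `v`,
when the value profile has law `V` and the others follow `s`. -/
def interimWin (A : FirstPriceAuction n) (V : Measure (Fin n → ℝ≥0)) [IsProbabilityMeasure V]
    (s : StrategyProfile n) (i : Fin n) (v b : ℝ≥0) : ℝ≥0∞ :=
  ∫⁻ w, ∫⁻ β, (A.alloc (Function.update β i b) i : ℝ≥0∞) ∂(s.bidLaw w)
    ∂(condDistrib (fun w : Fin n → ℝ≥0 => w) (fun w => w i) V v)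

/-- The interim utility of bidder `i` with value `v` and bid `b`. -/
def interimUtility (A : FirstPriceAuction n) (V : Measure (Fin n → ℝ≥0)) [IsProbabilityMeasure V]
    (s : StrategyProfile n) (i : Fin n) (v b : ℝ≥0) : ℝ :=
  ((v : ℝ) - (b : ℝ)) * (A.interimWin V s i v b).toReal

/-- Bayesian Nash equilibrium: for every bidder and (almost) every value of hers, the expected
interim utility of her strategy is at least the interim utility of any deviation bid.
As the utility is bounded above by the value, it fails to be integrable only if its expectation is
`-∞`, in which case the strategy is not optimal. -/
def IsBayesNashEquilibrium (A : FirstPriceAuction n) (V : Measure (Fin n → ℝ≥0))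
    [IsProbabilityMeasure V] (s : StrategyProfile n) : Prop :=
  ∀ i : Fin n, ∀ᵐ v ∂(V.map fun w => w i),
    Integrable (fun b => A.interimUtility V s i v b) (s.bid i v) ∧
    ∀ b' : ℝ≥0, A.interimUtility V s i v b' ≤ ∫ b, A.interimUtility V s i v b ∂(s.bid i v)

/-- The expected value of the winner. -/
def welfare (A : FirstPriceAuction n) (V : Measure (Fin n → ℝ≥0)) (s : StrategyProfile n) : ℝ≥0∞ :=
  ∫⁻ w, ∫⁻ β, ∑ i, (A.alloc β i : ℝ≥0∞) * (w i : ℝ≥0∞) ∂(s.bidLaw w) ∂V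

/-- The optimal welfare, the expected highest value. -/
def optWelfare (V : Measure (Fin n → ℝ≥0)) : ℝ≥0∞ :=
  ∫⁻ w, ((Finset.univ.sup w : ℝ≥0) : ℝ≥0∞) ∂V

/-- The Price of Stability over Bayesian Nash equilibria for correlated valuations. The infimum is
over all instances: a number of bidders, an arbitrary joint value distribution with positive finite
optimal welfare, and a first-price auction (i.e. a tie-breaking rule) that has an equilibrium. -/
def priceOfStability : ℝ≥0∞ :=
  ⨅ (n : ℕ) (V : Measure (Fin n → ℝ≥0)) (_ : IsProbabilityMeasure V)
    (_ : optWelfare V ≠ 0) (_ : optWelfare V ≠ ∞)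
    (A : FirstPriceAuction n) (_ : ∃ s, A.IsBayesNashEquilibrium V s),
    ⨆ (s : StrategyProfile n) (_ : A.IsBayesNashEquilibrium V s), A.welfare V s / optWelfare V

/-- The variant where the tie-breaking rule is not part of the instance but is selected together
with the equilibrium. -/
def priceOfStabilityFreeTies : ℝ≥0∞ :=
  ⨅ (n : ℕ) (V : Measure (Fin n → ℝ≥0)) (_ : IsProbabilityMeasure V)
    (_ : optWelfare V ≠ 0) (_ : optWelfare V ≠ ∞)
    (_ : ∃ (A : FirstPriceAuction n) (s : StrategyProfile n), A.IsBayesNashEquilibrium V s),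
    ⨆ (A : FirstPriceAuction n) (s : StrategyProfile n) (_ : A.IsBayesNashEquilibrium V s),
      A.welfare V s / optWelfare V

end FirstPriceAuction

end

/-! Both quantities are squeezed between two bounds that hold for every equilibrium under every
tie-breaking rule, so it does not matter who selects the rule.

Lower bound. Put `c = 1 - 1/e`. A bidder of value `v` may deviate to any bid `b` in `(0, c v]`, and
weighting these deviations with density `1/(v - b)`, of total mass `log e = 1`, shows that her
utility is at least the expectation of `(c v - m)⁺`, where `m` is the highest bid
(`lintegral_sub_highest_bid_le`). Only her own conditional law enters, so correlation is harmless.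
Utilities and payments sum to welfare, payments sum to `m`, and `(c v - m)⁺ + m ≥ c v` for the
bidder of highest value; this is `IsBayesNashEquilibrium.mul_optWelfare_le_welfare`.

Upper bound. Values are `(t, w, w)` with `t` and `w` independent, `t` slightly below `1` with
probability close to `1` and `0` otherwise, and `w` of an equal-revenue law with an atom `1/e` at
`0`. The two bidders of common value compete as in Bertrand's model, so one of them always bids at
least `w` (`IsBayesNashEquilibrium.measure_Iio_eq_zero`). Facing this, the first bidder cannot gain
by bidding above `0`, and since `t < 1` she strictly prefers `0`. She then wins with probability at
most `1/e`, and welfare is at most `1/e + E[w] = 1/e + (1 - 2/e) = 1 - 1/e`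
(`IsBayesNashEquilibrium.welfare_pairedLaw_le`), while the optimum is at least `E[t]`, which tends
to `1`. The instance has an equilibrium (`isBayesNashEquilibrium_passiveFirstBidder`), so it counts
in both infima. -/

/-! ### Integration against bid laws -/

namespace StrategyProfile

variable {n : ℕ}

instance (s : StrategyProfile n) (w : Fin n → ℝ≥0) : IsProbabilityMeasure (s.bidLaw w) := by
  unfold bidLaw; infer_instance

theorem measurable_bidLaw (s : StrategyProfile n) : Measurable s.bidLaw := by
  refine Measurable.measure_of_isPiSystem_of_isProbabilityMeasure generateFrom_pi.symm
    isPiSystem_pi ?_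
  rintro _ ⟨t, ht, rfl⟩
  simp only [bidLaw, Measure.pi_pi]
  refine Finset.measurable_prod _ fun i _ => ?_
  exact ((s.bid i).measurable_coe (ht i (Set.mem_univ i))).comp (measurable_pi_apply i)

/-- The law of the bid profile as a kernel in the value profile. -/
noncomputable def bidKernel (s : StrategyProfile n) : Kernel (Fin n → ℝ≥0) (Fin n → ℝ≥0) :=
  ⟨s.bidLaw, s.measurable_bidLaw⟩

theorem bidKernel_apply (s : StrategyProfile n) (w : Fin n → ℝ≥0) :
    s.bidKernel w = s.bidLaw w := rfl

instance (s : StrategyProfile n) : IsMarkovKernel s.bidKernel :=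
  ⟨fun w => by rw [bidKernel_apply]; infer_instance⟩

theorem measurable_lintegral_bidLaw {α : Type*} [MeasurableSpace α] (s : StrategyProfile n)
    {g : α → Fin n → ℝ≥0} (hg : Measurable g) {f : α → (Fin n → ℝ≥0) → ℝ≥0∞}
    (hf : Measurable (Function.uncurry f)) :
    Measurable fun a => ∫⁻ β, f a β ∂(s.bidLaw (g a)) :=
  Measurable.lintegral_kernel_prod_right (κ := s.bidKernel.comap g hg) hf

end StrategyProfile

/-- Resampling one coordinate does not change the integral against a product measure. -/
theorem lintegral_pi_update {ι : Type*} [Fintype ι] [DecidableEq ι] {X : ι → Type*}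
    [∀ i, MeasurableSpace (X i)] (μ : ∀ i, Measure (X i)) [∀ i, IsProbabilityMeasure (μ i)]
    (i : ι) {f : (∀ i, X i) → ℝ≥0∞} (hf : Measurable f) :
    ∫⁻ y, ∫⁻ x, f (Function.update x i y) ∂(Measure.pi μ) ∂(μ i) = ∫⁻ x, f x ∂(Measure.pi μ) := by
  have hu : Measurable fun p : (∀ i, X i) × X i => Function.update p.1 i p.2 :=
    measurable_update'
  have hg : Measurable fun x : (∀ i, X i) => ∫⁻ y, f (Function.update x i y) ∂(μ i) :=
    Measurable.lintegral_prod_right' (f := fun p : (∀ i, X i) × X i => f (Function.update p.1 i p.2))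
      (hf.comp hu)
  rw [lintegral_lintegral_swap]
  · refine lintegral_eq_of_lmarginal_eq {i} hg hf ?_
    simp only [lmarginal_singleton]
    ext x
    simp
  · exact (hf.comp (hu.comp measurable_swap)).aemeasurable

/-! ### Allocation, revenue and interim utilities -/

namespace FirstPriceAuction

variable {n : ℕ}

theorem sum_coe_alloc (A : FirstPriceAuction n) (β : Fin n → ℝ≥0) :
    ∑ i, (A.alloc β i : ℝ≥0∞) = 1 := by
  exact_mod_cast congrArg ((↑) : ℝ≥0 → ℝ≥0∞) (A.sum_alloc β)

theorem coe_alloc_le_one (A : FirstPriceAuction n) (β : Fin n → ℝ≥0) (i : Fin n) :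
    (A.alloc β i : ℝ≥0∞) ≤ 1 :=
  A.sum_coe_alloc β ▸ Finset.single_le_sum (f := fun i => (A.alloc β i : ℝ≥0∞))
    (fun _ _ => zero_le) (Finset.mem_univ i)

theorem alloc_mul_bid (A : FirstPriceAuction n) (β : Fin n → ℝ≥0) (i : Fin n) :
    (A.alloc β i : ℝ≥0∞) * β i = A.alloc β i * (Finset.univ.sup β : ℝ≥0) := by
  by_cases h : A.alloc β i = 0
  · simp [h]
  · congr 2
    exact le_antisymm (Finset.le_sup (Finset.mem_univ i))
      (Finset.sup_le fun j _ => A.highest_of_alloc_ne_zero β i h j)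

/-- The revenue of a first-price auction is the highest bid. -/
theorem sum_alloc_mul_bid (A : FirstPriceAuction n) (β : Fin n → ℝ≥0) :
    ∑ i, (A.alloc β i : ℝ≥0∞) * β i = (Finset.univ.sup β : ℝ≥0) := by
  simp_rw [A.alloc_mul_bid, ← Finset.sum_mul, A.sum_coe_alloc, one_mul]

theorem alloc_eq_zero_of_lt (A : FirstPriceAuction n) {β : Fin n → ℝ≥0} {i j : Fin n}
    (h : β i < β j) : A.alloc β i = 0 := by
  by_contra h0
  exact absurd (A.highest_of_alloc_ne_zero β i h0 j) (not_le.2 h)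

theorem coe_alloc_eq_one (A : FirstPriceAuction n) {β : Fin n → ℝ≥0} {i : Fin n}
    (h : ∀ j ≠ i, β j < β i) : (A.alloc β i : ℝ≥0∞) = 1 := by
  rw [← A.sum_coe_alloc β, Finset.sum_eq_single i]
  · intro j _ hj
    rw [A.alloc_eq_zero_of_lt (h j hj), ENNReal.coe_zero]
  · simp

theorem measurable_coe_alloc (A : FirstPriceAuction n) (i : Fin n) :
    Measurable fun β => (A.alloc β i : ℝ≥0∞) :=
  (A.measurable_alloc i).coe_nnreal_ennreal

theorem measurable_alloc_update (A : FirstPriceAuction n) (i : Fin n) :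
    Measurable fun p : ℝ≥0 × (Fin n → ℝ≥0) =>
      (A.alloc (Function.update p.2 i p.1) i : ℝ≥0∞) :=
  (A.measurable_coe_alloc i).comp
    (measurable_update'.comp measurable_swap : Measurable fun p : ℝ≥0 × (Fin n → ℝ≥0) =>
      Function.update p.2 i p.1)

theorem measurable_interimWin (A : FirstPriceAuction n) (V : Measure (Fin n → ℝ≥0))
    [IsProbabilityMeasure V] (s : StrategyProfile n) (i : Fin n) :
    Measurable fun p : ℝ≥0 × ℝ≥0 => A.interimWin V s i p.1 p.2 := by
  unfold interimWin
  refine Measurable.lintegral_kernel_prod_right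
    (κ := (condDistrib (fun w : Fin n → ℝ≥0 => w) (fun w => w i) V).comap Prod.fst measurable_fst)
    (f := fun (p : ℝ≥0 × ℝ≥0) w => ∫⁻ β, (A.alloc (Function.update β i p.2) i : ℝ≥0∞)
      ∂(s.bidLaw w)) ?_
  refine s.measurable_lintegral_bidLaw measurable_snd
    (f := fun (q : (ℝ≥0 × ℝ≥0) × (Fin n → ℝ≥0)) β =>
      (A.alloc (Function.update β i q.1.2) i : ℝ≥0∞)) ?_
  exact (A.measurable_alloc_update i).comp
    (by fun_prop : Measurable fun r : ((ℝ≥0 × ℝ≥0) × (Fin n → ℝ≥0)) × (Fin n → ℝ≥0) =>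
      (r.1.1.2, r.2))

theorem interimWin_le_one (A : FirstPriceAuction n) (V : Measure (Fin n → ℝ≥0))
    [IsProbabilityMeasure V] (s : StrategyProfile n) (i : Fin n) (v b : ℝ≥0) :
    A.interimWin V s i v b ≤ 1 := by
  unfold interimWin
  refine (lintegral_mono (g := fun _ => 1) fun w => ?_).trans (by simp)
  refine (lintegral_mono (g := fun _ => 1) fun β => ?_).trans (by simp)
  exact A.coe_alloc_le_one _ _

/-- The tower property: the whole profile is disintegrated along one coordinate, so the conditioning
value may be replaced by that coordinate. -/
theorem lintegral_lintegral_condDistrib_eval (V : Measure (Fin n → ℝ≥0))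
    [IsProbabilityMeasure V] (i : Fin n) {F : ℝ≥0 → (Fin n → ℝ≥0) → ℝ≥0∞}
    (hF : Measurable (Function.uncurry F)) :
    ∫⁻ v, ∫⁻ w, F v w ∂(condDistrib (fun w : Fin n → ℝ≥0 => w) (fun w => w i) V v)
      ∂(V.map fun w => w i) = ∫⁻ w, F (w i) w ∂V := by
  have h := compProd_map_condDistrib (mβ := inferInstance) (X := fun w : Fin n → ℝ≥0 => w i)
    (Y := fun w : Fin n → ℝ≥0 => w) (μ := V) aemeasurable_id
  have h2 := Measure.lintegral_compProd (μ := V.map fun w => w i)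
    (κ := condDistrib (fun w : Fin n → ℝ≥0 => w) (fun w => w i) V) hF
  rw [h, lintegral_map hF (by fun_prop)] at h2
  exact h2.symm

/-- In equilibrium, almost every type `v` of a bidder has an equilibrium utility `M`, which is the
difference of expected value and expected payment, and which no deviation exceeds. -/
theorem IsBayesNashEquilibrium.exists_utility {A : FirstPriceAuction n}
    {V : Measure (Fin n → ℝ≥0)} [IsProbabilityMeasure V] {s : StrategyProfile n}
    (h : A.IsBayesNashEquilibrium V s) (i : Fin n) :
    ∀ᵐ v ∂(V.map fun w => w i), ∃ M : ℝ≥0∞,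
      M + ∫⁻ b, b * A.interimWin V s i v b ∂(s.bid i v)
        = ∫⁻ b, v * A.interimWin V s i v b ∂(s.bid i v) ∧
      (∀ b : ℝ≥0, ((v - b : ℝ≥0) : ℝ≥0∞) * A.interimWin V s i v b ≤ M) ∧
      M ≤ ∫⁻ b, ((v - b : ℝ≥0) : ℝ≥0∞) * A.interimWin V s i v b ∂(s.bid i v) := by
  filter_upwards [h i] with v hv
  obtain ⟨hint, hdev⟩ := hv
  have hfin : ∀ b, A.interimWin V s i v b ≠ ∞ := fun b =>
    ne_top_of_le_ne_top ENNReal.one_ne_top (A.interimWin_le_one V s i v b)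
  have hmeas : Measurable fun b => A.interimWin V s i v b :=
    (A.measurable_interimWin V s i).comp measurable_prodMk_left
  have hpos : ∀ b : ℝ≥0, ENNReal.ofReal (A.interimUtility V s i v b)
      = ((v - b : ℝ≥0) : ℝ≥0∞) * A.interimWin V s i v b := fun b => by
    rw [interimUtility, ENNReal.ofReal_mul' ENNReal.toReal_nonneg, ENNReal.ofReal_toReal (hfin b),
      NNReal.sub_def]
    rfl
  have hval : Integrable (fun b => (v : ℝ) * (A.interimWin V s i v b).toReal) (s.bid i v) := by
    refine Integrable.const_mul ?_ _
    refine Integrable.of_bound hmeas.ennreal_toReal.aestronglyMeasurable 1 (.of_forall fun b => ?_)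
    rw [Real.norm_of_nonneg ENNReal.toReal_nonneg]
    exact ENNReal.toReal_le_of_le_ofReal zero_le_one (by simpa using A.interimWin_le_one V s i v b)
  have hpay : Integrable (fun b : ℝ≥0 => (b : ℝ) * (A.interimWin V s i v b).toReal) (s.bid i v) := by
    refine (hval.sub hint).congr (.of_forall fun b => ?_)
    simp only [Pi.sub_apply, interimUtility]
    ring
  have hsum : (∫ b, A.interimUtility V s i v b ∂(s.bid i v))
      + ∫ b : ℝ≥0, (b : ℝ) * (A.interimWin V s i v b).toReal ∂(s.bid i v)
      = ∫ b, (v : ℝ) * (A.interimWin V s i v b).toReal ∂(s.bid i v) := by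
    rw [← integral_add hint hpay]
    congr 1 with b
    simp only [interimUtility]
    ring
  -- Bidding one's own value earns exactly zero, so equilibrium utility is nonnegative and survives
  -- the passage to `ℝ≥0∞`.
  have hM : 0 ≤ ∫ b, A.interimUtility V s i v b ∂(s.bid i v) :=
    le_trans (by simp [interimUtility]) (hdev v)
  have hof : ∀ c b : ℝ≥0, ENNReal.ofReal ((c : ℝ) * (A.interimWin V s i v b).toReal)
      = c * A.interimWin V s i v b := fun c b => by
    rw [ENNReal.ofReal_mul c.coe_nonneg, ENNReal.ofReal_toReal (hfin b), ENNReal.ofReal_coe_nnreal]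
  refine ⟨ENNReal.ofReal (∫ b, A.interimUtility V s i v b ∂(s.bid i v)), ?_, fun b => ?_, ?_⟩
  · have hnn : ∀ c : ℝ≥0 → ℝ≥0, 0 ≤ fun b => (c b : ℝ) * (A.interimWin V s i v b).toReal :=
      fun c b => mul_nonneg (c b).coe_nonneg ENNReal.toReal_nonneg
    simp_rw [← hof]
    rw [← ofReal_integral_eq_lintegral_ofReal hval (.of_forall (hnn fun _ => v)),
      ← ofReal_integral_eq_lintegral_ofReal hpay (.of_forall (hnn fun b => b)), ← hsum,
      ENNReal.ofReal_add hM (integral_nonneg (hnn fun b => b))]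
  · rw [← hpos]
    exact ENNReal.ofReal_le_ofReal (hdev b)
  · simp_rw [← hpos]
    refine ENNReal.ofReal_le_of_le_toReal ?_
    rw [integral_eq_lintegral_pos_part_sub_lintegral_neg_part hint]
    exact sub_le_self _ ENNReal.toReal_nonneg

end FirstPriceAuction

/-! ### Lower bound: welfare of an arbitrary equilibrium -/

theorem one_div_exp_one_lt_one : 1 / Real.exp 1 < 1 := by
  rw [div_lt_one (Real.exp_pos 1)]
  simp

namespace FirstPriceAuction

variable {n : ℕ}

/-- The source of the constant: the integral is `log (v / (v - c v))` with `c = 1 - 1/e`, and this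
equals `log e = 1`. -/
theorem lintegral_inv_sub_le_one {v : ℝ} (hv : 0 < v) :
    ∫⁻ b in Set.Ioc 0 ((1 - 1 / Real.exp 1) * v), ENNReal.ofReal (v - b)⁻¹ ≤ 1 := by
  set c := 1 - 1 / Real.exp 1 with hc
  have he : 1 / Real.exp 1 < 1 := one_div_exp_one_lt_one
  have hc0 : 0 ≤ c * v := mul_nonneg (by linarith) hv.le
  have hcv : 0 < v - c * v := by
    have : v - c * v = 1 / Real.exp 1 * v := by rw [hc]; ring
    rw [this]; positivity
  have hpos : ∀ b ∈ Set.Icc 0 (c * v), 0 < v - b := fun b hb => by linarith [hb.2]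
  have hcont : ContinuousOn (fun b : ℝ => (v - b)⁻¹) (Set.Icc 0 (c * v)) :=
    (continuousOn_const.sub continuousOn_id).inv₀ fun b hb => (hpos b hb).ne'
  rw [← ofReal_integral_eq_lintegral_ofReal
    (hcont.integrableOn_Icc.mono_set Set.Ioc_subset_Icc_self)
    ((ae_restrict_iff' measurableSet_Ioc).2 <| .of_forall fun b hb =>
      (inv_pos.2 (hpos b (Set.Ioc_subset_Icc_self hb))).le),
    ← intervalIntegral.integral_of_le hc0,
    intervalIntegral.integral_comp_sub_left (fun x => x⁻¹), sub_zero, integral_inv_of_pos hcv hv]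
  have : v / (v - c * v) = Real.exp 1 := by
    rw [hc]
    field_simp
    ring
  rw [this, Real.log_exp, ENNReal.ofReal_one]

/-- The maximum includes the discarded bid of `i`, which only shrinks the event; strictness makes
the tie-breaking rule irrelevant. -/
theorem indicator_le_alloc_update (A : FirstPriceAuction n) (β : Fin n → ℝ≥0) (i : Fin n)
    (b : ℝ≥0) :
    {β : Fin n → ℝ≥0 | Finset.univ.sup β < b}.indicator (fun _ => (1 : ℝ≥0∞)) β
      ≤ A.alloc (Function.update β i b) i := by
  refine Set.indicator_apply_le' (fun h => ?_) fun _ => zero_le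
  rw [A.coe_alloc_eq_one]
  intro j hj
  simp only [Function.update_of_ne hj, Function.update_self]
  exact (Finset.le_sup (Finset.mem_univ j)).trans_lt h

theorem measurable_sup_univ : Measurable fun β : Fin n → ℝ≥0 => Finset.univ.sup β := by
  refine measurable_of_Iic fun a => ?_
  have : (fun β : Fin n → ℝ≥0 => Finset.univ.sup β) ⁻¹' Set.Iic a
      = ⋂ i, {β : Fin n → ℝ≥0 | β i ≤ a} := by
    ext β
    simp
  rw [this]
  exact MeasurableSet.iInter fun i => measurableSet_le (measurable_pi_apply i) measurable_const

/-- Averaging the deviations to bids `b` with density `1 / (v - b)` bounds the utility of a bidder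
of value `v` from below. -/
theorem lintegral_sub_highest_bid_le (A : FirstPriceAuction n) (V : Measure (Fin n → ℝ≥0))
    [IsProbabilityMeasure V] (s : StrategyProfile n) (i : Fin n) (v : ℝ≥0) {M : ℝ≥0∞}
    (hM : ∀ b : ℝ≥0, ((v - b : ℝ≥0) : ℝ≥0∞) * A.interimWin V s i v b ≤ M) :
    ∫⁻ w, ∫⁻ β, ENNReal.ofReal ((1 - 1 / Real.exp 1) * v - (Finset.univ.sup β : ℝ≥0))
      ∂(s.bidLaw w) ∂(condDistrib (fun w : Fin n → ℝ≥0 => w) (fun w => w i) V v) ≤ M := by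
  set c := 1 - 1 / Real.exp 1 with hc
  rcases eq_or_lt_of_le (zero_le : 0 ≤ v) with rfl | hv
  · simp [ENNReal.ofReal_of_nonpos]
  have hsup := measurable_sup_univ (n := n)
  set κ := condDistrib (fun w : Fin n → ℝ≥0 => w) (fun w => w i) V v
  set η : Measure (Fin n → ℝ≥0) := s.bidKernel ∘ₘ κ
  have hη : ∀ f : (Fin n → ℝ≥0) → ℝ≥0∞, Measurable f →
      ∫⁻ w, ∫⁻ β, f β ∂(s.bidLaw w) ∂κ = ∫⁻ β, f β ∂η := fun f hf =>
    (Measure.lintegral_bind s.bidKernel.aemeasurable hf.aemeasurable).symm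
  have hset : MeasurableSet {p : ℝ × (Fin n → ℝ≥0) | ((Finset.univ.sup p.2 : ℝ≥0) : ℝ) < p.1} :=
    measurableSet_lt (hsup.comp measurable_snd).coe_nnreal_real measurable_fst
  calc
    _ = ∫⁻ β, ENNReal.ofReal (c * (v : ℝ) - (Finset.univ.sup β : ℝ≥0)) ∂η :=
      hη _ (measurable_const.sub hsup.coe_nnreal_real).ennreal_ofReal
    -- Layer cake: `(c v - m)⁺` is the length of the part of `(0, c v]` above `m`.
    _ = ∫⁻ β, (∫⁻ b in Set.Ioc (0 : ℝ) (c * v), {p : ℝ × (Fin n → ℝ≥0) |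
          ((Finset.univ.sup p.2 : ℝ≥0) : ℝ) < p.1}.indicator (fun _ => 1) (b, β)) ∂η := by
      congr 1 with β
      have : ∀ b, {p : ℝ × (Fin n → ℝ≥0) | ((Finset.univ.sup p.2 : ℝ≥0) : ℝ) < p.1}.indicator
          (fun _ => (1 : ℝ≥0∞)) (b, β)
          = (Set.Ioi ((Finset.univ.sup β : ℝ≥0) : ℝ)).indicator (fun _ => 1) b := fun b => rfl
      simp_rw [this]
      rw [lintegral_indicator_const measurableSet_Ioi, one_mul,
        Measure.restrict_apply measurableSet_Ioi, Set.inter_comm, Set.Ioc_inter_Ioi,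
        Real.volume_Ioc, sup_eq_right.2 (NNReal.coe_nonneg _)]
    _ = ∫⁻ b in Set.Ioc (0 : ℝ) (c * v), ∫⁻ β, {p : ℝ × (Fin n → ℝ≥0) |
          ((Finset.univ.sup p.2 : ℝ≥0) : ℝ) < p.1}.indicator (fun _ => 1) (b, β) ∂η :=
      lintegral_lintegral_swap (f := fun β b => {p : ℝ × (Fin n → ℝ≥0) |
          ((Finset.univ.sup p.2 : ℝ≥0) : ℝ) < p.1}.indicator (fun _ => 1) (b, β))
        ((measurable_const.indicator hset).comp measurable_swap).aemeasurable
    _ ≤ ∫⁻ b in Set.Ioc 0 (c * v), ENNReal.ofReal (v - b)⁻¹ * M := by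
      refine setLIntegral_mono' measurableSet_Ioc fun b hb => ?_
      have hb0 : 0 ≤ b := hb.1.le
      have hbv : 0 < v - b := by
        have : (v : ℝ) - c * v = 1 / Real.exp 1 * v := by rw [hc]; ring
        have : 0 < 1 / Real.exp 1 * (v : ℝ) := by positivity
        linarith [hb.2]
      lift b to ℝ≥0 using hb0
      calc
        _ = ∫⁻ w, ∫⁻ β, {β : Fin n → ℝ≥0 | Finset.univ.sup β < b}.indicator
              (fun _ => (1 : ℝ≥0∞)) β ∂(s.bidLaw w) ∂κ := by
          rw [hη _ (measurable_const.indicator (measurableSet_lt hsup measurable_const))]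
          refine lintegral_congr fun β => ?_
          simp [Set.indicator]
        _ ≤ A.interimWin V s i v b :=
          lintegral_mono fun w => lintegral_mono fun β => A.indicator_le_alloc_update β i b
        -- The density cancels the profit margin `v - b`, which is positive because `b ≤ c v < v`.
        _ = ENNReal.ofReal (v - b)⁻¹ * (((v - b : ℝ≥0) : ℝ≥0∞) * A.interimWin V s i v b) := by
          have : ENNReal.ofReal ((v : ℝ) - b)⁻¹ * ((v - b : ℝ≥0) : ℝ≥0∞) = 1 := by
            rw [NNReal.sub_def, ← ENNReal.ofReal, ← ENNReal.ofReal_mul (inv_pos.2 hbv).le,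
              inv_mul_cancel₀ hbv.ne', ENNReal.ofReal_one]
          rw [← mul_assoc, this, one_mul]
        _ ≤ _ := mul_le_mul_right (hM b) _
    _ = (∫⁻ b in Set.Ioc 0 (c * v), ENNReal.ofReal (v - b)⁻¹) * M :=
      lintegral_mul_const _ (measurable_const.sub measurable_id).inv.ennreal_ofReal
    _ ≤ 1 * M := mul_le_mul_left (lintegral_inv_sub_le_one (by exact_mod_cast hv)) _
    _ = M := one_mul M

/-- Passage from interim to ex ante: given the values, a bidder's own bid is independent of the
others', so inserting a fresh draw of it leaves the law of the bid profile unchanged. -/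
theorem lintegral_lintegral_mul_interimWin (A : FirstPriceAuction n) (V : Measure (Fin n → ℝ≥0))
    [IsProbabilityMeasure V] (s : StrategyProfile n) (i : Fin n) {g : ℝ≥0 → ℝ≥0 → ℝ≥0∞}
    (hg : Measurable (Function.uncurry g)) :
    ∫⁻ v, ∫⁻ b, g v b * A.interimWin V s i v b ∂(s.bid i v) ∂(V.map fun w => w i)
      = ∫⁻ w, ∫⁻ β, g (w i) (β i) * A.alloc β i ∂(s.bidLaw w) ∂V := by
  have hgi : Measurable fun q : (ℝ≥0 × (Fin n → ℝ≥0)) × ℝ≥0 × (Fin n → ℝ≥0) =>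
      g q.1.1 q.2.1 * A.alloc (Function.update q.2.2 i q.2.1) i :=
    (hg.comp (by fun_prop : Measurable fun q : (ℝ≥0 × (Fin n → ℝ≥0)) × ℝ≥0 × (Fin n → ℝ≥0) =>
      (q.1.1, q.2.1))).mul ((A.measurable_alloc_update i).comp measurable_snd)
  have hin : Measurable fun q : (ℝ≥0 × (Fin n → ℝ≥0)) × ℝ≥0 =>
      ∫⁻ β, g q.1.1 q.2 * A.alloc (Function.update β i q.2) i ∂(s.bidLaw q.1.2) :=
    s.measurable_lintegral_bidLaw (g := fun q : (ℝ≥0 × (Fin n → ℝ≥0)) × ℝ≥0 => q.1.2)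
      (by fun_prop)
      (f := fun q β => g q.1.1 q.2 * A.alloc (Function.update β i q.2) i)
      (hgi.comp (by fun_prop : Measurable fun r : ((ℝ≥0 × (Fin n → ℝ≥0)) × ℝ≥0) × (Fin n → ℝ≥0) =>
        (r.1.1, (r.1.2, r.2))))
  have hout : Measurable (Function.uncurry fun (v : ℝ≥0) (w : Fin n → ℝ≥0) =>
      ∫⁻ b, ∫⁻ β, g v b * A.alloc (Function.update β i b) i ∂(s.bidLaw w) ∂(s.bid i v)) :=
    Measurable.lintegral_kernel_prod_right
      (κ := (s.bid i).comap (Prod.fst : ℝ≥0 × (Fin n → ℝ≥0) → ℝ≥0) measurable_fst) hin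
  calc
    _ = ∫⁻ v, ∫⁻ w, ∫⁻ b, ∫⁻ β, g v b * A.alloc (Function.update β i b) i ∂(s.bidLaw w)
          ∂(s.bid i v) ∂(condDistrib (fun w : Fin n → ℝ≥0 => w) (fun w => w i) V v)
          ∂(V.map fun w => w i) := by
      congr 1 with v
      rw [lintegral_lintegral_swap (f := fun w b =>
        ∫⁻ β, g v b * A.alloc (Function.update β i b) i ∂(s.bidLaw w)) (hin.comp
        (by fun_prop : Measurable fun r : (Fin n → ℝ≥0) × ℝ≥0 => ((v, r.1), r.2))).aemeasurable]
      refine lintegral_congr fun b => ?_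
      have hm : Measurable fun β : Fin n → ℝ≥0 =>
          (A.alloc (Function.update β i b) i : ℝ≥0∞) :=
        (A.measurable_alloc_update i).comp measurable_prodMk_left
      simp_rw [lintegral_const_mul _ hm]
      rw [lintegral_const_mul _ (s.measurable_lintegral_bidLaw (g := fun w => w) measurable_id
        (f := fun _ β => (A.alloc (Function.update β i b) i : ℝ≥0∞)) (hm.comp measurable_snd))]
      rfl
    _ = ∫⁻ w, ∫⁻ b, ∫⁻ β, g (w i) b * A.alloc (Function.update β i b) i ∂(s.bidLaw w)
          ∂(s.bid i (w i)) ∂V := lintegral_lintegral_condDistrib_eval V i hout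
    _ = _ := by
      congr 1 with w
      have hf : Measurable fun β : Fin n → ℝ≥0 => g (w i) (β i) * A.alloc β i :=
        (hg.comp (by fun_prop : Measurable fun β : Fin n → ℝ≥0 => (w i, β i))).mul
          (A.measurable_coe_alloc i)
      rw [StrategyProfile.bidLaw, ← lintegral_pi_update (fun j => s.bid j (w j)) i hf]
      simp

/-- The deviation bound averaged over the bidder's types; the payment stays on the left to avoid
subtraction in `ℝ≥0∞`. -/
theorem IsBayesNashEquilibrium.lintegral_sub_add_payment_le {A : FirstPriceAuction n}
    {V : Measure (Fin n → ℝ≥0)} [IsProbabilityMeasure V] {s : StrategyProfile n}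
    (h : A.IsBayesNashEquilibrium V s) (i : Fin n) :
    ∫⁻ w, ∫⁻ β, ENNReal.ofReal ((1 - 1 / Real.exp 1) * w i - (Finset.univ.sup β : ℝ≥0))
        ∂(s.bidLaw w) ∂V
      + ∫⁻ w, ∫⁻ β, β i * A.alloc β i ∂(s.bidLaw w) ∂V
      ≤ ∫⁻ w, ∫⁻ β, w i * A.alloc β i ∂(s.bidLaw w) ∂V := by
  have hsup := measurable_sup_univ (n := n)
  have hsub : Measurable (Function.uncurry fun (v : ℝ≥0) (w : Fin n → ℝ≥0) =>
      ∫⁻ β, ENNReal.ofReal ((1 - 1 / Real.exp 1) * v - (Finset.univ.sup β : ℝ≥0))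
        ∂(s.bidLaw w)) :=
    s.measurable_lintegral_bidLaw (g := (Prod.snd : ℝ≥0 × (Fin n → ℝ≥0) → _)) measurable_snd
      (f := fun q β => ENNReal.ofReal ((1 - 1 / Real.exp 1) * q.1 - (Finset.univ.sup β : ℝ≥0)))
      (Measurable.ennreal_ofReal <| (measurable_fst.fst.coe_nnreal_real.const_mul _).sub
        (hsup.comp measurable_snd).coe_nnreal_real)
  rw [← lintegral_lintegral_condDistrib_eval V i hsub,
    ← A.lintegral_lintegral_mul_interimWin V s i (g := fun _ b => b)
      measurable_snd.coe_nnreal_ennreal,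
    ← A.lintegral_lintegral_mul_interimWin V s i (g := fun v _ => v)
      measurable_fst.coe_nnreal_ennreal,
    ← lintegral_add_left (Measurable.lintegral_kernel_prod_right
      (κ := (condDistrib (fun w : Fin n → ℝ≥0 => w) (fun w => w i) V)) hsub)]
  refine lintegral_mono_ae ?_
  filter_upwards [h.exists_utility i] with v ⟨M, hM, hdev, _⟩
  rw [← hM]
  gcongr
  exact A.lintegral_sub_highest_bid_le V s i v hdev

/-- Every Bayesian Nash equilibrium has at least a `1 - 1/e` fraction of the optimal welfare. -/
theorem IsBayesNashEquilibrium.mul_optWelfare_le_welfare {A : FirstPriceAuction n}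
    {V : Measure (Fin n → ℝ≥0)} [IsProbabilityMeasure V] {s : StrategyProfile n}
    (h : A.IsBayesNashEquilibrium V s) :
    ENNReal.ofReal (1 - 1 / Real.exp 1) * optWelfare V ≤ A.welfare V s := by
  have hsup := measurable_sup_univ (n := n)
  set c := 1 - 1 / Real.exp 1 with hc
  have hc0 : 0 ≤ c := sub_nonneg.2 one_div_exp_one_lt_one.le
  have hm1 : ∀ i : Fin n, Measurable fun q : (Fin n → ℝ≥0) × (Fin n → ℝ≥0) =>
      ENNReal.ofReal (c * q.1 i - (Finset.univ.sup q.2 : ℝ≥0)) := fun i =>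
    Measurable.ennreal_ofReal <| (((measurable_pi_apply i).comp
      measurable_fst).coe_nnreal_real.const_mul _).sub (hsup.comp measurable_snd).coe_nnreal_real
  have hm2 : ∀ i : Fin n, Measurable fun q : (Fin n → ℝ≥0) × (Fin n → ℝ≥0) =>
      (q.2 i : ℝ≥0∞) * A.alloc q.2 i := fun i =>
    (((measurable_pi_apply i).comp measurable_snd).coe_nnreal_ennreal).mul
      ((A.measurable_coe_alloc i).comp measurable_snd)
  have hm3 : ∀ i : Fin n, Measurable fun q : (Fin n → ℝ≥0) × (Fin n → ℝ≥0) =>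
      (q.1 i : ℝ≥0∞) * A.alloc q.2 i := fun i =>
    (((measurable_pi_apply i).comp measurable_fst).coe_nnreal_ennreal).mul
      ((A.measurable_coe_alloc i).comp measurable_snd)
  have hM : ∀ {F : (Fin n → ℝ≥0) × (Fin n → ℝ≥0) → ℝ≥0∞}, Measurable F →
      Measurable fun w => ∫⁻ β, F (w, β) ∂(s.bidLaw w) := fun {F} hF =>
    s.measurable_lintegral_bidLaw measurable_id (f := fun w β => F (w, β)) hF
  have hsum : ∀ {F : Fin n → (Fin n → ℝ≥0) × (Fin n → ℝ≥0) → ℝ≥0∞},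
      (∀ i, Measurable (F i)) →
      ∑ i, ∫⁻ w, ∫⁻ β, F i (w, β) ∂(s.bidLaw w) ∂V
        = ∫⁻ w, ∫⁻ β, ∑ i, F i (w, β) ∂(s.bidLaw w) ∂V := fun {F} hF => by
    rw [← lintegral_finsetSum _ fun i _ => hM (hF i)]
    refine lintegral_congr fun w => ?_
    exact (lintegral_finsetSum _ fun i _ => (hF i).comp measurable_prodMk_left).symm
  have hkey := Finset.sum_le_sum fun i (_ : i ∈ Finset.univ) => h.lintegral_sub_add_payment_le i
  have hM1 := hM (Finset.measurable_fun_sum Finset.univ fun i _ => hm1 i)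
  have hs1 := hsum hm1
  have hs2 := hsum hm2
  have hs3 := hsum hm3
  dsimp only at hM1 hs1 hs2 hs3
  rw [Finset.sum_add_distrib, ← hc, hs1, hs2, hs3, ← lintegral_add_left hM1] at hkey
  have hwel : A.welfare V s = ∫⁻ w, ∫⁻ β, ∑ i, (w i : ℝ≥0∞) * A.alloc β i ∂(s.bidLaw w) ∂V := by
    simp only [welfare, mul_comm]
  rw [hwel, optWelfare, ← lintegral_const_mul _ hsup.coe_nnreal_ennreal]
  refine le_trans (lintegral_mono fun w => ?_) hkey
  have hmw : Measurable fun β : Fin n → ℝ≥0 =>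
      ∑ i, ENNReal.ofReal (c * w i - (Finset.univ.sup β : ℝ≥0)) :=
    Finset.measurable_fun_sum _ fun i _ => (hm1 i).comp (measurable_prodMk_left (x := w))
  rw [← lintegral_add_left hmw]
  have hconst : ENNReal.ofReal c * (Finset.univ.sup w : ℝ≥0)
      = ∫⁻ _, ENNReal.ofReal c * (Finset.univ.sup w : ℝ≥0) ∂(s.bidLaw w) := by
    rw [lintegral_const, measure_univ, mul_one]
  rw [hconst]
  refine lintegral_mono fun β => ?_
  simp_rw [mul_comm (β _ : ℝ≥0∞), A.sum_alloc_mul_bid]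
  rcases isEmpty_or_nonempty (Fin n) with he | hne
  · simp
  -- Of the summed deviation bounds, only that of a bidder of highest value is kept.
  obtain ⟨i, -, hi⟩ := Finset.exists_mem_eq_sup Finset.univ Finset.univ_nonempty w
  rw [hi]
  calc
    ENNReal.ofReal c * (w i : ℝ≥0∞) = ENNReal.ofReal (c * w i) := by
      rw [ENNReal.ofReal_mul hc0, ENNReal.ofReal_coe_nnreal]
    _ ≤ ENNReal.ofReal (c * w i - (Finset.univ.sup β : ℝ≥0)) + (Finset.univ.sup β : ℝ≥0) := by
      rw [← ENNReal.ofReal_coe_nnreal (p := Finset.univ.sup β)]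
      refine le_trans (ENNReal.ofReal_le_ofReal (by simp)) ENNReal.ofReal_add_le
    _ ≤ _ := by
      gcongr
      exact Finset.single_le_sum (f := fun i => ENNReal.ofReal (c * w i - (Finset.univ.sup β : ℝ≥0)))
        (fun _ _ => zero_le) (Finset.mem_univ i)

end FirstPriceAuction

/-! ### Product and conditional laws for three bidders -/

theorem measurable_vec_three {X : Type*} [MeasurableSpace X] {a b c : X → ℝ≥0}
    (ha : Measurable a) (hb : Measurable b) (hc : Measurable c) :
    Measurable fun x => ![a x, b x, c x] := by
  refine measurable_pi_iff.2 fun i => ?_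
  fin_cases i
  exacts [ha, hb, hc]

theorem pi_three_eq_map (μ : Fin 3 → Measure ℝ≥0) [∀ i, IsProbabilityMeasure (μ i)] :
    Measure.pi μ = ((μ 0).prod ((μ 1).prod (μ 2))).map fun p => ![p.1, p.2.1, p.2.2] := by
  have hm : Measurable fun p : ℝ≥0 × ℝ≥0 × ℝ≥0 => ![p.1, p.2.1, p.2.2] :=
    measurable_vec_three (by fun_prop) (by fun_prop) (by fun_prop)
  refine (Measure.pi_eq fun t ht => ?_)
  rw [Measure.map_apply hm (MeasurableSet.univ_pi ht)]
  have : (fun p : ℝ≥0 × ℝ≥0 × ℝ≥0 => ![p.1, p.2.1, p.2.2]) ⁻¹' Set.univ.pi t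
      = t 0 ×ˢ (t 1 ×ˢ t 2) := by
    ext p
    simp [Fin.forall_fin_succ]
  rw [this, Measure.prod_prod, Measure.prod_prod, Fin.prod_univ_three, mul_assoc]

theorem lintegral_pi_three (μ : Fin 3 → Measure ℝ≥0) [∀ i, IsProbabilityMeasure (μ i)]
    {f : (Fin 3 → ℝ≥0) → ℝ≥0∞} (hf : Measurable f) :
    ∫⁻ β, f β ∂(Measure.pi μ)
      = ∫⁻ x, ∫⁻ y, ∫⁻ z, f ![x, y, z] ∂(μ 2) ∂(μ 1) ∂(μ 0) := by
  have hm : Measurable fun p : ℝ≥0 × ℝ≥0 × ℝ≥0 => ![p.1, p.2.1, p.2.2] :=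
    measurable_vec_three (by fun_prop) (by fun_prop) (by fun_prop)
  have hfm : Measurable fun p : ℝ≥0 × ℝ≥0 × ℝ≥0 => f ![p.1, p.2.1, p.2.2] := hf.comp hm
  rw [pi_three_eq_map, lintegral_map hf hm, lintegral_prod _ hfm.aemeasurable]
  exact lintegral_congr fun x => lintegral_prod _ (hfm.comp measurable_prodMk_left).aemeasurable

/-- The conditional law of an outcome `g (t, w)` of independent `t` and `w`, given `t`. -/
theorem lintegral_condDistrib_map_prod {Ω : Type*} [MeasurableSpace Ω] [StandardBorelSpace Ω]
    [Nonempty Ω] (μ ν : Measure ℝ≥0) [IsProbabilityMeasure μ] [IsProbabilityMeasure ν]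
    {V : Measure Ω} [IsProbabilityMeasure V] {g : ℝ≥0 × ℝ≥0 → Ω} (hg : Measurable g)
    (hV : V = (μ.prod ν).map g) {X : Ω → ℝ≥0} (hX : Measurable X) (hXg : ∀ p, X (g p) = p.1) :
    V.map X = μ ∧ ∀ᵐ t ∂μ, ∀ f : Ω → ℝ≥0∞, Measurable f →
      ∫⁻ y, f y ∂(condDistrib (fun y : Ω => y) X V t) = ∫⁻ w, f (g (t, w)) ∂ν := by
  have hmap : V.map X = μ := by
    rw [hV, Measure.map_map hX hg]
    have : X ∘ g = Prod.fst := funext hXg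
    rw [this, Measure.map_fst_prod, measure_univ, one_smul]
  refine ⟨hmap, ?_⟩
  -- The evident version of the conditional law: keep `t`, draw `w` afresh, apply `g`. Almost
  -- everywhere uniqueness identifies it with `condDistrib`.
  set κ : Kernel ℝ≥0 Ω := (Kernel.id ×ₖ Kernel.const ℝ≥0 ν).map g with hκ
  have hκf : ∀ t, ∀ f : Ω → ℝ≥0∞, Measurable f → ∫⁻ y, f y ∂(κ t) = ∫⁻ w, f (g (t, w)) ∂ν := by
    intro t f hf
    rw [hκ, Kernel.lintegral_map _ hg _ hf]
    exact Kernel.lintegral_id_prod (f := fun p => f (g p)) (hf.comp hg) _ _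
  have : IsMarkovKernel κ := Kernel.IsMarkovKernel.map _ hg
  have h := condDistrib_ae_eq_of_measure_eq_compProd (μ := V) (Y := fun y => y) (κ := κ) X
    aemeasurable_id (by
      rw [hmap]
      refine Measure.ext_of_lintegral _ fun f hf => ?_
      have hXi : Measurable fun y => (X y, y) := hX.prodMk measurable_id
      rw [Measure.lintegral_compProd hf, hV, lintegral_map hf hXi,
        lintegral_map (f := fun y => f (X y, y)) (hf.comp hXi) hg,
        lintegral_prod (fun p => f (X (g p), g p)) ((hf.comp hXi).comp hg).aemeasurable]
      refine lintegral_congr fun t => ?_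
      rw [hκf t (fun y => f (t, y)) (hf.comp measurable_prodMk_left)]
      simp [hXg])
  rw [hmap] at h
  filter_upwards [h] with t ht f hf
  rw [ht, hκf t f hf]

/-! ### Bertrand competition in randomized bids -/

/-- A finite measure whose distribution function is bounded away from zero almost everywhere
vanishes. -/
theorem measure_eq_zero_of_ae_le_measure_Iio (ρ : Measure ℝ≥0) [IsFiniteMeasure ρ] {m : ℝ≥0∞}
    (hm : m ≠ 0) (h : ∀ᵐ t ∂ρ, m ≤ ρ (Set.Iio t)) : ρ = 0 := by
  have hm0 : 0 < m := pos_iff_ne_zero.2 hm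
  set D : Set ℝ≥0 := {t | ρ (Set.Iio t) < m} with hD
  have hρD : ρ D = 0 := by
    have : D = {t | ¬ m ≤ ρ (Set.Iio t)} := by ext t; simp [hD]
    rw [this]
    exact h
  have hlow : ∀ t ∈ D, ∀ u ≤ t, u ∈ D := fun t ht u hu =>
    (measure_mono (Set.Iio_subset_Iio hu)).trans_lt ht
  by_cases hb : BddAbove D
  swap
  · have : D = Set.univ := by
      refine Set.eq_univ_of_forall fun u => ?_
      obtain ⟨t, ht, hut⟩ := not_bddAbove_iff.1 hb u
      exact hlow t ht u hut.le
    rwa [this, Measure.measure_univ_eq_zero] at hρD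
  exfalso
  have hne : D.Nonempty := ⟨0, by simpa [hD] using hm0⟩
  set l := sSup D with hl
  have hlt : ∀ u < l, u ∈ D := fun u hu => by
    obtain ⟨t, ht, hut⟩ := exists_lt_of_lt_csSup hne hu
    exact hlow t ht u hut.le
  -- Everything strictly below `l` lies in the null set `D`, so the supremum is attained. Then `Iic
  -- l` is null, yet continuity from above along points outside `D` gives it mass at least `m`.
  have hlD : l ∈ D := by
    have : ρ (Set.Iio l) = 0 := measure_mono_null (fun u hu => hlt u hu) hρD
    simpa [hD, this] using hm0
  have hIic : ρ (Set.Iic l) = 0 := measure_mono_null (fun u hu => hlow l hlD u hu) hρD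
  obtain ⟨u, hu, hul, hlim⟩ := exists_seq_strictAnti_tendsto l
  have hInter : ⋂ k, Set.Iio (u k) = Set.Iic l := by
    ext x
    simp only [Set.mem_iInter, Set.mem_Iio, Set.mem_Iic]
    exact ⟨fun hx => ge_of_tendsto' hlim fun k => (hx k).le, fun hx k => hx.trans_lt (hul k)⟩
  have htend := tendsto_measure_iInter_atTop (μ := ρ) (s := fun k => Set.Iio (u k))
    (fun k => measurableSet_Iio.nullMeasurableSet)
    (fun i j hij => Set.Iio_subset_Iio (hu.antitone hij)) ⟨0, measure_ne_top _ _⟩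
  rw [hInter, hIic] at htend
  have : m ≤ 0 := ge_of_tendsto' htend fun k => by
    by_contra hk
    exact absurd (le_csSup hb (show u k ∈ D from not_le.1 hk)) (not_le.2 (hul k))
  exact hm (le_antisymm this zero_le)

/-- In a symmetric competition of two bidders with randomized bids, where a bid `b` that beats the
rival yields `Φ b`, at least one of the bidders makes no profit. -/
theorem bertrand_competition {β γ : Measure ℝ≥0} [IsProbabilityMeasure β] [IsProbabilityMeasure γ]
    {Φ : ℝ≥0 → ℝ≥0∞} (hΦ : Measurable Φ) {C U₁ U₂ : ℝ≥0∞} (hC : C ≠ ∞) (hΦC : ∀ b, Φ b ≤ C)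
    (hU₁ : U₁ ≠ ∞) (hU₂ : U₂ ≠ ∞)
    (h₁ : ∀ b, Φ b * γ (Set.Iic b) ≤ U₁) (h₂ : ∀ b, Φ b * β (Set.Iic b) ≤ U₂)
    (h : U₁ + U₂ ≤ ∫⁻ y, ∫⁻ z, Φ (max y z) ∂γ ∂β) : U₁ = 0 ∨ U₂ = 0 := by
  have hstep : ∀ {β γ : Measure ℝ≥0} [IsProbabilityMeasure β] [IsProbabilityMeasure γ]
      {U₁ U₂ : ℝ≥0∞}, U₁ ≠ ∞ → U₂ ≠ ∞ → (∀ b, Φ b * γ (Set.Iic b) ≤ U₁) →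
      (∀ b, Φ b * β (Set.Iic b) ≤ U₂) → (U₁ + U₂ ≤ ∫⁻ y, ∫⁻ z, Φ (max y z) ∂γ ∂β) →
      ∀ᵐ z ∂γ, U₂ ≤ C * β (Set.Iio z) := by
    intro β γ _ _ U₁ U₂ hU₁ hU₂ h₁ h₂ h
    have hle : MeasurableSet {p : ℝ≥0 × ℝ≥0 | p.2 ≤ p.1} :=
      measurableSet_le measurable_snd measurable_fst
    have hlt : MeasurableSet {p : ℝ≥0 × ℝ≥0 | p.1 < p.2} :=
      measurableSet_lt measurable_fst measurable_snd
    have hmle : Measurable fun p : ℝ≥0 × ℝ≥0 =>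
        {p : ℝ≥0 × ℝ≥0 | p.2 ≤ p.1}.indicator (fun p => Φ p.1) p :=
      (hΦ.comp measurable_fst).indicator hle
    have hmlt : Measurable fun p : ℝ≥0 × ℝ≥0 =>
        {p : ℝ≥0 × ℝ≥0 | p.1 < p.2}.indicator (fun p => Φ p.2) p :=
      (hΦ.comp measurable_snd).indicator hlt
    -- Split by who bids higher, giving ties to the first bidder. Her part is at most `U₁`, so the
    -- other part must account for all of `U₂`.
    have hsplit : ∫⁻ y, ∫⁻ z, Φ (max y z) ∂γ ∂β
        = ∫⁻ y, Φ y * γ (Set.Iic y) ∂β + ∫⁻ z, Φ z * β (Set.Iio z) ∂γ := by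
      calc
        _ = ∫⁻ y, ∫⁻ z, ({p : ℝ≥0 × ℝ≥0 | p.2 ≤ p.1}.indicator (fun p => Φ p.1) (y, z)
              + {p : ℝ≥0 × ℝ≥0 | p.1 < p.2}.indicator (fun p => Φ p.2) (y, z)) ∂γ ∂β := by
          refine lintegral_congr fun y => lintegral_congr fun z => ?_
          rcases le_or_gt z y with hzy | hzy
          · simp [hzy, not_lt.2 hzy]
          · simp [hzy, hzy.le, not_le.2 hzy]
        _ = (∫⁻ y, ∫⁻ z, {p : ℝ≥0 × ℝ≥0 | p.2 ≤ p.1}.indicator (fun p => Φ p.1) (y, z) ∂γ ∂β)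
            + ∫⁻ y, ∫⁻ z, {p : ℝ≥0 × ℝ≥0 | p.1 < p.2}.indicator (fun p => Φ p.2) (y, z) ∂γ ∂β := by
          rw [← lintegral_add_left hmle.lintegral_prod_right']
          refine lintegral_congr fun y => ?_
          exact lintegral_add_left (hmle.comp (measurable_prodMk_left (x := y))) _
        _ = _ := by
          congr 1
          · refine lintegral_congr fun y => ?_
            have : ∀ z, {p : ℝ≥0 × ℝ≥0 | p.2 ≤ p.1}.indicator (fun p => Φ p.1) (y, z)
                = (Set.Iic y).indicator (fun _ => Φ y) z := fun z => rfl
            simp_rw [this]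
            rw [lintegral_indicator_const measurableSet_Iic]
          · rw [lintegral_lintegral_swap (f := fun y z =>
              {p : ℝ≥0 × ℝ≥0 | p.1 < p.2}.indicator (fun p => Φ p.2) (y, z)) hmlt.aemeasurable]
            refine lintegral_congr fun z => ?_
            have : ∀ y, {p : ℝ≥0 × ℝ≥0 | p.1 < p.2}.indicator (fun p => Φ p.2) (y, z)
                = (Set.Iio z).indicator (fun _ => Φ z) y := fun y => rfl
            simp_rw [this]
            rw [lintegral_indicator_const measurableSet_Iio]
    have hfirst : ∫⁻ y, Φ y * γ (Set.Iic y) ∂β ≤ U₁ :=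
      (lintegral_mono h₁).trans (by simp)
    have hsecond : U₂ ≤ ∫⁻ z, Φ z * β (Set.Iio z) ∂γ := by
      rw [hsplit] at h
      exact (ENNReal.add_le_add_iff_left hU₁).1 (h.trans (by gcongr))
    have hpt : ∀ z, Φ z * β (Set.Iio z) ≤ U₂ := fun z =>
      (mul_le_mul_right (measure_mono Set.Iio_subset_Iic_self) _).trans (h₂ z)
    -- A pointwise upper bound that is reached on average is reached almost surely: almost every bid
    -- of the second bidder earns `U₂`, hence beats the rival with probability bounded below.
    have hae := ae_eq_of_ae_le_of_lintegral_le (μ := γ) (g := fun _ => U₂)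
      (.of_forall hpt)
      (ne_top_of_le_ne_top hU₂ ((lintegral_mono hpt).trans (by simp)))
      aemeasurable_const (by simpa using hsecond)
    filter_upwards [hae] with z hz
    rw [← hz]
    exact mul_le_mul_left (hΦC z) _
  by_contra! hU
  obtain ⟨hU₁', hU₂'⟩ := hU
  have hγ := hstep hU₁ hU₂ h₁ h₂ h
  have hβ := hstep hU₂ hU₁ h₂ h₁ (by
    rw [add_comm]
    refine h.trans (le_of_eq ?_)
    rw [lintegral_lintegral_swap (f := fun y z => Φ (max y z))
      (hΦ.comp (measurable_fst.max measurable_snd)).aemeasurable]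
    simp_rw [max_comm])
  -- If both profits were positive, almost every bid under either law would have mass at least `m`
  -- of `β + γ` strictly below it, which fails at the bottom of the support.
  have hρ : (β + γ : Measure ℝ≥0) = 0 := by
    refine measure_eq_zero_of_ae_le_measure_Iio (β + γ) (m := min (U₁ / C) (U₂ / C)) ?_ ?_
    · exact (lt_min (ENNReal.div_pos hU₁' hC) (ENNReal.div_pos hU₂' hC)).ne'
    · rw [ae_add_measure_iff]
      constructor
      · filter_upwards [hβ] with t ht
        refine (min_le_left _ _).trans ((ENNReal.div_le_of_le_mul' ht).trans ?_)
        exact Measure.le_iff'.1 (Measure.le_add_left le_rfl) _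
      · filter_upwards [hγ] with t ht
        refine (min_le_right _ _).trans ((ENNReal.div_le_of_le_mul' ht).trans ?_)
        exact Measure.le_iff'.1 (Measure.le_add_right le_rfl) _
  have : (β + γ : Measure ℝ≥0) Set.univ = 0 := by rw [hρ]; simp
  simp at this

theorem of_ae_of_measure_singleton_ne_zero {α : Type*} [MeasurableSpace α] {μ : Measure α}
    {p : α → Prop} (h : ∀ᵐ x ∂μ, p x) {a : α} (ha : μ {a} ≠ 0) : p a := by
  by_contra hp
  exact ha (measure_mono_null (Set.singleton_subset_iff.2 hp) (ae_iff.1 h))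

/-! ### Winning probabilities when two bidders share their value -/

namespace FirstPriceAuction

/-- The law of `(t, w, w)` for independent `t` and `w` of laws `μ` and `ν`. -/
noncomputable def pairedLaw (μ ν : Measure ℝ≥0) : Measure (Fin 3 → ℝ≥0) :=
  (μ.prod ν).map fun p => ![p.1, p.2, p.2]

theorem measurable_paired : Measurable fun p : ℝ≥0 × ℝ≥0 => ![p.1, p.2, p.2] :=
  measurable_vec_three measurable_fst measurable_snd measurable_snd

section

variable (μ ν : Measure ℝ≥0)

theorem lintegral_pairedLaw [SFinite ν] {f : (Fin 3 → ℝ≥0) → ℝ≥0∞} (hf : Measurable f) :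
    ∫⁻ w, f w ∂(pairedLaw μ ν) = ∫⁻ t, ∫⁻ w, f ![t, w, w] ∂ν ∂μ := by
  rw [pairedLaw, lintegral_map hf measurable_paired]
  exact lintegral_prod (fun p : ℝ≥0 × ℝ≥0 => f ![p.1, p.2, p.2])
    (hf.comp measurable_paired).aemeasurable

theorem pairedLaw_singleton_zero [SFinite ν] : pairedLaw μ ν {0} = μ {0} * ν {0} := by
  rw [pairedLaw, Measure.map_apply measurable_paired (measurableSet_singleton _),
    ← Measure.prod_prod]
  congr 1
  ext p
  simp [funext_iff, Fin.forall_fin_succ, Prod.ext_iff]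

variable [IsProbabilityMeasure μ] [IsProbabilityMeasure ν]

instance : IsProbabilityMeasure (pairedLaw μ ν) :=
  Measure.isProbabilityMeasure_map measurable_paired.aemeasurable

/-- Puts the common value in the first factor, so that the conditional-law lemma also applies to
bidders `1` and `2`. -/
theorem pairedLaw_eq_map_swap :
    pairedLaw μ ν = (ν.prod μ).map fun p => ![p.2, p.1, p.1] := by
  rw [pairedLaw, ← Measure.prod_swap, Measure.map_map measurable_paired measurable_swap]
  rfl

theorem map_eval_zero_pairedLaw : (pairedLaw μ ν).map (fun w => w 0) = μ :=
  (lintegral_condDistrib_map_prod μ ν (V := pairedLaw μ ν) measurable_paired rfl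
    (measurable_pi_apply 0) fun _ => rfl).1

theorem map_eval_one_pairedLaw : (pairedLaw μ ν).map (fun w => w 1) = ν :=
  (lintegral_condDistrib_map_prod ν μ (measurable_paired.comp measurable_swap)
    (pairedLaw_eq_map_swap μ ν) (measurable_pi_apply 1) fun _ => rfl).1

theorem map_eval_two_pairedLaw : (pairedLaw μ ν).map (fun w => w 2) = ν :=
  (lintegral_condDistrib_map_prod ν μ (measurable_paired.comp measurable_swap)
    (pairedLaw_eq_map_swap μ ν) (measurable_pi_apply 2) fun _ => rfl).1

variable (A : FirstPriceAuction 3) (s : StrategyProfile 3)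

theorem measurable_lintegral_alloc_update (i : Fin 3) (b : ℝ≥0) :
    Measurable fun w => ∫⁻ β, (A.alloc (Function.update β i b) i : ℝ≥0∞) ∂(s.bidLaw w) :=
  s.measurable_lintegral_bidLaw measurable_id
    (f := fun _ β => (A.alloc (Function.update β i b) i : ℝ≥0∞))
    (((A.measurable_alloc_update i).comp measurable_prodMk_left).comp measurable_snd)

theorem measurable_coe_alloc_vec {X : Type*} [MeasurableSpace X] (i : Fin 3) {a b c : X → ℝ≥0}
    (ha : Measurable a) (hb : Measurable b) (hc : Measurable c) :
    Measurable fun x => (A.alloc ![a x, b x, c x] i : ℝ≥0∞) :=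
  (A.measurable_coe_alloc i).comp (measurable_vec_three ha hb hc)

/-- By independence of `t` and `w`, the first bidder's type says nothing about her rivals, so the
right-hand side does not involve `t`. -/
theorem interimWin_zero_pairedLaw : ∀ᵐ t ∂μ, ∀ b,
    A.interimWin (pairedLaw μ ν) s 0 t b
      = ∫⁻ w, ∫⁻ y, ∫⁻ z, A.alloc ![b, y, z] 0 ∂(s.bid 2 w) ∂(s.bid 1 w) ∂ν := by
  filter_upwards [(lintegral_condDistrib_map_prod μ ν (V := pairedLaw μ ν) measurable_paired rfl
    (measurable_pi_apply (0 : Fin 3)) fun _ => rfl).2] with t ht b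
  refine (ht _ (measurable_lintegral_alloc_update A s 0 b)).trans ?_
  refine lintegral_congr fun w => ?_
  refine (lintegral_pi_three _
    ((A.measurable_alloc_update 0).comp (measurable_prodMk_left (x := b)))).trans ?_
  have : ∀ x y z : ℝ≥0, Function.update ![x, y, z] 0 b = ![b, y, z] := fun x y z => by
    ext i
    fin_cases i <;> rfl
  simp [this]

/-- Her value reveals her twin's value; about the first bidder only the type-averaged bid law
matters. -/
theorem interimWin_one_pairedLaw : ∀ᵐ w ∂ν, ∀ b,
    A.interimWin (pairedLaw μ ν) s 1 w b
      = ∫⁻ z, ∫⁻ x, A.alloc ![x, b, z] 1 ∂(s.bid 0 ∘ₘ μ) ∂(s.bid 2 w) := by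
  filter_upwards [(lintegral_condDistrib_map_prod ν μ (measurable_paired.comp measurable_swap)
    (pairedLaw_eq_map_swap μ ν) (measurable_pi_apply (1 : Fin 3)) fun _ => rfl).2] with w hw b
  refine (hw _ (measurable_lintegral_alloc_update A s 1 b)).trans ?_
  have hu : ∀ x y z : ℝ≥0, Function.update ![x, y, z] 1 b = ![x, b, z] := fun x y z => by
    ext i
    fin_cases i <;> rfl
  have hm : Measurable fun p : ℝ≥0 × ℝ≥0 => (A.alloc ![p.1, b, p.2] 1 : ℝ≥0∞) :=
    measurable_coe_alloc_vec A 1 measurable_fst measurable_const measurable_snd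
  rw [lintegral_lintegral_swap
    (f := fun z x => (A.alloc ![x, b, z] 1 : ℝ≥0∞)) (hm.comp measurable_swap).aemeasurable,
    Measure.lintegral_bind (s.bid 0).aemeasurable hm.lintegral_prod_right'.aemeasurable]
  refine lintegral_congr fun t => ?_
  refine (lintegral_pi_three _
    ((A.measurable_alloc_update 1).comp (measurable_prodMk_left (x := b)))).trans ?_
  simp [hu]

theorem interimWin_two_pairedLaw : ∀ᵐ w ∂ν, ∀ b,
    A.interimWin (pairedLaw μ ν) s 2 w b
      = ∫⁻ y, ∫⁻ x, A.alloc ![x, y, b] 2 ∂(s.bid 0 ∘ₘ μ) ∂(s.bid 1 w) := by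
  filter_upwards [(lintegral_condDistrib_map_prod ν μ (measurable_paired.comp measurable_swap)
    (pairedLaw_eq_map_swap μ ν) (measurable_pi_apply (2 : Fin 3)) fun _ => rfl).2] with w hw b
  refine (hw _ (measurable_lintegral_alloc_update A s 2 b)).trans ?_
  have hu : ∀ x y z : ℝ≥0, Function.update ![x, y, z] 2 b = ![x, y, b] := fun x y z => by
    ext i
    fin_cases i <;> rfl
  have hm : Measurable fun p : ℝ≥0 × ℝ≥0 => (A.alloc ![p.1, p.2, b] 2 : ℝ≥0∞) :=
    measurable_coe_alloc_vec A 2 measurable_fst measurable_snd measurable_const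
  rw [lintegral_lintegral_swap
    (f := fun y x => (A.alloc ![x, y, b] 2 : ℝ≥0∞)) (hm.comp measurable_swap).aemeasurable,
    Measure.lintegral_bind (s.bid 0).aemeasurable hm.lintegral_prod_right'.aemeasurable]
  refine lintegral_congr fun t => ?_
  refine (lintegral_pi_three _
    ((A.measurable_alloc_update 2).comp (measurable_prodMk_left (x := b)))).trans ?_
  simp [hu]

end

/-! ### Structure of all equilibria of the three-bidder instance -/

/-- If all values vanish with positive probability, then in equilibrium bidders of value `0`
bid `0`. -/
theorem IsBayesNashEquilibrium.bid_zero_singleton {n : ℕ} {A : FirstPriceAuction n}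
    {V : Measure (Fin n → ℝ≥0)} [IsProbabilityMeasure V] {s : StrategyProfile n}
    (h : A.IsBayesNashEquilibrium V s) (hV : V {0} ≠ 0) (i : Fin n) : s.bid i 0 {0} = 1 := by
  have hpay : ∀ j, ∫⁻ β, β j * A.alloc β j ∂(s.bidLaw 0) = 0 := by
    intro j
    -- Counts payments of zero types only. Such types get no value, so their expected payments
    -- vanish; the positive mass of the zero profile turns this into a statement at that profile.
    set g : ℝ≥0 → ℝ≥0 → ℝ≥0∞ := fun v b => if v = 0 then b else 0 with hg
    have hgm : Measurable (Function.uncurry g) :=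
      Measurable.ite (measurable_fst (measurableSet_singleton 0))
        measurable_snd.coe_nnreal_ennreal measurable_const
    have hzero : ∫⁻ v, ∫⁻ b, g v b * A.interimWin V s j v b ∂(s.bid j v)
        ∂(V.map fun w => w j) = 0 := by
      rw [← lintegral_zero (μ := V.map fun w => w j)]
      refine lintegral_congr_ae ?_
      filter_upwards [h.exists_utility j] with v ⟨M, hM, _, _⟩
      by_cases hv : v = 0
      · subst hv
        simp only [ENNReal.coe_zero, zero_mul, lintegral_zero, add_eq_zero] at hM
        simpa [hg] using hM.2
      · simp [hg, hv]
    rw [A.lintegral_lintegral_mul_interimWin V s j hgm, lintegral_eq_zero_iff] at hzero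
    · have := of_ae_of_measure_singleton_ne_zero hzero hV
      simpa [hg] using this
    · refine s.measurable_lintegral_bidLaw measurable_id
        (f := fun w β => g (w j) (β j) * A.alloc β j) ?_
      exact (hgm.comp (by fun_prop : Measurable fun p : (Fin n → ℝ≥0) × (Fin n → ℝ≥0) =>
        (p.1 j, p.2 j))).mul ((A.measurable_coe_alloc j).comp measurable_snd)
  -- Revenue is the highest bid, so zero revenue forces all bids to be `0`.
  have hsup : ∫⁻ β, ((Finset.univ.sup β : ℝ≥0) : ℝ≥0∞) ∂(s.bidLaw 0) = 0 := by
    simp_rw [← A.sum_alloc_mul_bid, mul_comm]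
    rw [lintegral_finsetSum (f := fun j (β : Fin n → ℝ≥0) => (β j : ℝ≥0∞) * A.alloc β j) _ fun j _ =>
      (measurable_pi_apply j).coe_nnreal_ennreal.mul (A.measurable_coe_alloc j)]
    exact Finset.sum_eq_zero fun j _ => hpay j
  rw [lintegral_eq_zero_iff measurable_sup_univ.coe_nnreal_ennreal] at hsup
  have hmap := (measurePreserving_eval (fun j => s.bid j ((0 : Fin n → ℝ≥0) j)) i).map_eq
  have hi : ∀ᵐ b ∂(s.bid i 0), b = 0 := by
    have : ∀ᵐ b ∂((s.bidLaw 0).map (Function.eval i)), b = 0 := by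
      refine (ae_map_iff (p := fun b => b = 0) (measurable_pi_apply i).aemeasurable
        (measurableSet_singleton 0)).2 ?_
      filter_upwards [hsup] with β hβ
      have h0 : Finset.univ.sup β = 0 := by simpa using hβ
      exact le_antisymm (h0 ▸ Finset.le_sup (Finset.mem_univ i)) zero_le
    rw [StrategyProfile.bidLaw, hmap] at this
    exact this
  exact (prob_compl_eq_zero_iff (measurableSet_singleton 0)).1 hi

end FirstPriceAuction

theorem measurable_coe_sub (v : ℝ≥0) : Measurable fun b : ℝ≥0 => ((v - b : ℝ≥0) : ℝ≥0∞) :=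
  (measurable_const.sub measurable_id).coe_nnreal_ennreal

/-- If every bid slightly above `b` earns at most `U`, then so does the bid `b` itself, provided
that it wins all ties. -/
theorem sub_mul_le_of_forall_lt {v b : ℝ≥0} {X U : ℝ≥0∞} (hX : X ≠ ∞)
    (h : ∀ b' > b, ((v - b' : ℝ≥0) : ℝ≥0∞) * X ≤ U) : ((v - b : ℝ≥0) : ℝ≥0∞) * X ≤ U := by
  have hc : Continuous fun b' : ℝ≥0 => ((v - b' : ℝ≥0) : ℝ≥0∞) := by fun_prop
  refine le_of_tendsto (x := nhdsWithin b (Set.Ioi b)) (ENNReal.Tendsto.mul_const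
    ((hc.tendsto b).mono_left nhdsWithin_le_nhds) (Or.inr hX)) ?_
  filter_upwards [self_mem_nhdsWithin] with b' hb' using h b' hb'

theorem measure_Iio_mul_measure_Iio_le (G γ : Measure ℝ≥0) {F : ℝ≥0 → ℝ≥0 → ℝ≥0∞} {b : ℝ≥0}
    (hF : ∀ x < b, ∀ z < b, 1 ≤ F x z) :
    G (Set.Iio b) * γ (Set.Iio b) ≤ ∫⁻ z, ∫⁻ x, F x z ∂G ∂γ := by
  have h1 : ∀ ρ : Measure ℝ≥0, ρ (Set.Iio b) = ∫⁻ x, (Set.Iio b).indicator 1 x ∂ρ := fun ρ =>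
    (lintegral_indicator_one measurableSet_Iio).symm
  rw [h1 γ, ← lintegral_const_mul _ (measurable_one.indicator measurableSet_Iio)]
  refine lintegral_mono fun z => ?_
  by_cases hz : z < b
  · simp only [Set.mem_Iio, hz, Set.indicator_of_mem, Pi.one_apply, mul_one]
    rw [h1 G]
    refine lintegral_mono fun x => ?_
    exact Set.indicator_apply_le' (fun hx => hF x hx z hz) fun _ => zero_le
  · simp [hz]

theorem measure_Iio_eq_zero_of_forall_Iic {γ : Measure ℝ≥0} {w : ℝ≥0}
    (h : ∀ b < w, γ (Set.Iic b) = 0) : γ (Set.Iio w) = 0 := by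
  rcases eq_or_lt_of_le (zero_le : 0 ≤ w) with rfl | hw
  · simp
  obtain ⟨u, -, hu, hlim⟩ := exists_seq_strictMono_tendsto' hw
  refine measure_mono_null (t := ⋃ k, Set.Iic (u k)) (fun x hx => ?_)
    (measure_iUnion_null fun k => h _ (hu k).2)
  obtain ⟨k, hk⟩ := (hlim.eventually (lt_mem_nhds hx)).exists
  exact Set.mem_iUnion.2 ⟨k, hk.le⟩

namespace FirstPriceAuction

section

variable {μ ν : Measure ℝ≥0} [IsProbabilityMeasure μ] [IsProbabilityMeasure ν]
  {A : FirstPriceAuction 3} {s : StrategyProfile 3}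

/-- In equilibrium, one of the two bidders of common value `w` never bids less than `w`. -/
theorem IsBayesNashEquilibrium.measure_Iio_eq_zero
    (h : A.IsBayesNashEquilibrium (pairedLaw μ ν) s) (hG : (s.bid 0 ∘ₘ μ) {0} ≠ 0) :
    ∀ᵐ w ∂ν, s.bid 1 w (Set.Iio w) = 0 ∨ s.bid 2 w (Set.Iio w) = 0 := by
  set G := s.bid 0 ∘ₘ μ
  have e1 := h.exists_utility 1
  have e2 := h.exists_utility 2
  rw [map_eval_one_pairedLaw] at e1
  rw [map_eval_two_pairedLaw] at e2
  filter_upwards [e1, e2, interimWin_one_pairedLaw μ ν A s, interimWin_two_pairedLaw μ ν A s]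
    with w ⟨U₁, _, hdev₁, hle₁⟩ ⟨U₂, _, hdev₂, hle₂⟩ hW₁ hW₂
  set β := s.bid 1 w
  set γ := s.bid 2 w
  -- Profit from a bid that beats the twin: the margin times the probability that the first bidder
  -- does not bid higher.
  set Φ : ℝ≥0 → ℝ≥0∞ := fun b => ((w - b : ℝ≥0) : ℝ≥0∞) * G (Set.Iic b) with hΦ
  have hmono : Monotone fun b : ℝ≥0 => G (Set.Iic b) := fun a b hab =>
    measure_mono (Set.Iic_subset_Iic.2 hab)
  have hΦm : Measurable Φ := (measurable_coe_sub w).mul hmono.measurable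
  have hΦw : ∀ b, Φ b ≤ w := fun b =>
    (mul_le_mul' (ENNReal.coe_le_coe.2 tsub_le_self) prob_le_one).trans (mul_one _).le
  -- Bidding slightly above `b` wins every tie at `b`, so closed half-lines are admissible under any
  -- tie-breaking rule.
  have hdevle : ∀ (γ : Measure ℝ≥0) [IsProbabilityMeasure γ] (W : ℝ≥0 → ℝ≥0∞) (U : ℝ≥0∞),
      (∀ b, G (Set.Iio b) * γ (Set.Iio b) ≤ W b) → (∀ b, ((w - b : ℝ≥0) : ℝ≥0∞) * W b ≤ U) →
      ∀ b, Φ b * γ (Set.Iic b) ≤ U := by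
    intro γ _ W U hW hU b
    rw [hΦ, mul_assoc]
    refine sub_mul_le_of_forall_lt (ENNReal.mul_ne_top (measure_ne_top _ _) (measure_ne_top _ _))
      fun b' hb' => le_trans ?_ (hU b')
    gcongr
    refine le_trans ?_ (hW b')
    gcongr
  have h₁ := hdevle γ _ U₁ (fun b => by
    rw [hW₁]
    refine measure_Iio_mul_measure_Iio_le G γ fun x hx z hz => (A.coe_alloc_eq_one ?_).ge
    intro j hj
    fin_cases j
    exacts [hx, absurd rfl hj, hz]) hdev₁
  have h₂ := hdevle β _ U₂ (fun b => by
    rw [hW₂]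
    refine measure_Iio_mul_measure_Iio_le G β fun x hx z hz => (A.coe_alloc_eq_one ?_).ge
    intro j hj
    fin_cases j
    exacts [hx, hz, absurd rfl hj]) hdev₂
  have hUw : ∀ (ρ : Measure ℝ≥0) [IsProbabilityMeasure ρ] (i : Fin 3) (U : ℝ≥0∞),
      U ≤ ∫⁻ b, ((w - b : ℝ≥0) : ℝ≥0∞) * A.interimWin (pairedLaw μ ν) s i w b ∂ρ → U ≠ ∞ := by
    intro ρ _ i U hU
    refine ne_top_of_le_ne_top (ENNReal.coe_ne_top (r := w))
      (hU.trans ((lintegral_mono (g := fun _ => (w : ℝ≥0∞)) fun b => ?_).trans (by simp)))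
    exact (mul_le_mul' (ENNReal.coe_le_coe.2 tsub_le_self)
      (A.interimWin_le_one _ s i w b)).trans (mul_one _).le
  have hm : ∀ i, Measurable fun p : (ℝ≥0 × ℝ≥0) × ℝ≥0 =>
      (A.alloc ![p.2, p.1.1, p.1.2] i : ℝ≥0∞) := fun i =>
    measurable_coe_alloc_vec A i (by fun_prop) (by fun_prop) (by fun_prop)
  have hm' : ∀ i, Measurable fun p : ℝ≥0 × ℝ≥0 => ∫⁻ x, (A.alloc ![x, p.1, p.2] i : ℝ≥0∞) ∂G :=
    fun i => (hm i).lintegral_prod_right'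
  have hsum : U₁ + U₂ ≤ ∫⁻ y, ∫⁻ z, Φ (max y z) ∂γ ∂β := by
    have hi₁ : U₁ ≤ ∫⁻ y, ∫⁻ z, ((w - y : ℝ≥0) : ℝ≥0∞) *
        ∫⁻ x, A.alloc ![x, y, z] 1 ∂G ∂γ ∂β := by
      refine hle₁.trans (le_of_eq (lintegral_congr fun y => ?_))
      rw [hW₁]
      exact (lintegral_const_mul _ ((hm' 1).comp measurable_prodMk_left)).symm
    have hi₂ : U₂ ≤ ∫⁻ y, ∫⁻ z, ((w - z : ℝ≥0) : ℝ≥0∞) *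
        ∫⁻ x, A.alloc ![x, y, z] 2 ∂G ∂γ ∂β := by
      rw [lintegral_lintegral_swap (f := fun y z => ((w - z : ℝ≥0) : ℝ≥0∞) *
        ∫⁻ x, A.alloc ![x, y, z] 2 ∂G)
        (((measurable_coe_sub w).comp measurable_snd).mul (hm' 2)).aemeasurable]
      refine hle₂.trans (le_of_eq (lintegral_congr fun z => ?_))
      rw [hW₂]
      exact (lintegral_const_mul _ ((hm' 2).comp measurable_prodMk_right)).symm
    have hF : Measurable fun p : ℝ≥0 × ℝ≥0 => ((w - p.1 : ℝ≥0) : ℝ≥0∞) *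
        ∫⁻ x, A.alloc ![x, p.1, p.2] 1 ∂G :=
      ((measurable_coe_sub w).comp measurable_fst).mul (hm' 1)
    refine (add_le_add hi₁ hi₂).trans ?_
    rw [← lintegral_add_left hF.lintegral_prod_right']
    refine lintegral_mono fun y => ?_
    have hFy : Measurable fun z => ((w - y : ℝ≥0) : ℝ≥0∞) * ∫⁻ x, A.alloc ![x, y, z] 1 ∂G :=
      hF.comp (measurable_prodMk_left (x := y))
    dsimp only
    rw [← lintegral_add_left hFy]
    refine lintegral_mono fun z => ?_
    dsimp only
    have hmx : ∀ i, Measurable fun x => (A.alloc ![x, y, z] i : ℝ≥0∞) := fun i =>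
      (hm i).comp (measurable_prodMk_left (x := (y, z)))
    rw [← lintegral_const_mul _ (hmx 1), ← lintegral_const_mul _ (hmx 2),
      ← lintegral_add_left ((hmx 1).const_mul _), hΦ]
    dsimp only
    rw [← lintegral_indicator_const measurableSet_Iic]
    refine lintegral_mono fun x => ?_
    -- A twin who wins holds the larger bid of the pair, and the first bidder is not above it; the
    -- two allocations together are at most `1`.
    have hb : ∀ i : Fin 3, i ≠ 0 →
        ((w - ![x, y, z] i : ℝ≥0) : ℝ≥0∞) * A.alloc ![x, y, z] i
        ≤ (Set.Iic (max y z)).indicator (fun _ => ((w - max y z : ℝ≥0) : ℝ≥0∞)) x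
          * A.alloc ![x, y, z] i := by
      intro i hi
      by_cases h0 : A.alloc ![x, y, z] i = 0
      · simp [h0]
      have htop := A.highest_of_alloc_ne_zero _ _ h0
      have hmax : max y z = ![x, y, z] i := by
        refine le_antisymm (max_le (htop 1) (htop 2)) ?_
        fin_cases i
        exacts [absurd rfl hi, le_max_left _ _, le_max_right _ _]
      have hx : x ∈ Set.Iic (max y z) := hmax ▸ htop 0
      rw [Set.indicator_of_mem hx, hmax]
    refine (add_le_add (hb 1 (by decide)) (hb 2 (by decide))).trans ?_
    rw [← mul_add]
    refine (mul_le_mul_right (?_ : _ ≤ (1 : ℝ≥0∞)) _).trans (mul_one _).le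
    rw [← A.sum_coe_alloc ![x, y, z], Fin.sum_univ_three, add_assoc]
    exact le_add_self
  -- The atom of `G` at `0` makes `Φ b` positive for all `b < w`. Hence a bidder without profit
  -- faces a rival who never bids below `w`.
  have hlast : ∀ ρ : Measure ℝ≥0, (∀ b, Φ b * ρ (Set.Iic b) ≤ 0) → ρ (Set.Iio w) = 0 := by
    intro ρ hρ
    refine measure_Iio_eq_zero_of_forall_Iic fun b hb => ?_
    have := le_antisymm (hρ b) zero_le
    rw [mul_eq_zero] at this
    refine this.resolve_left (mul_ne_zero ?_ fun h0 => hG (measure_mono_null ?_ h0))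
    · exact ENNReal.coe_ne_zero.2 (tsub_pos_of_lt hb).ne'
    · simp
  rcases bertrand_competition hΦm ENNReal.coe_ne_top hΦw (hUw β 1 U₁ hle₁) (hUw γ 2 U₂ hle₂)
    h₁ h₂ hsum with h0 | h0
  · exact Or.inr (hlast γ (h0 ▸ h₁))
  · exact Or.inl (hlast β (h0 ▸ h₂))

/-- Every equilibrium is inefficient if low types of the first bidder have positive probability and
no bid of a high type is profitable enough. -/
theorem IsBayesNashEquilibrium.welfare_pairedLaw_le
    (h : A.IsBayesNashEquilibrium (pairedLaw μ ν) s) (hμ : μ {0} ≠ 0) (hμ1 : ∀ᵐ t ∂μ, t < 1)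
    (hν : ν {0} ≠ 0) (hνb : ∀ b : ℝ≥0, ((1 - b : ℝ≥0) : ℝ≥0∞) * ν (Set.Iic b) ≤ ν {0}) :
    A.welfare (pairedLaw μ ν) s ≤ ν {0} + ∫⁻ w, w ∂ν := by
  have hV : pairedLaw μ ν {0} ≠ 0 := by
    rw [pairedLaw_singleton_zero]
    exact mul_ne_zero hμ hν
  have hbid := h.bid_zero_singleton hV
  have hG : (s.bid 0 ∘ₘ μ) {0} ≠ 0 := by
    rw [Measure.bind_apply (measurableSet_singleton 0) (s.bid 0).aemeasurable]
    intro h0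
    rw [lintegral_eq_zero_iff ((s.bid 0).measurable_coe (measurableSet_singleton 0))] at h0
    exact one_ne_zero ((hbid 0).symm.trans (of_ae_of_measure_singleton_ne_zero h0 hμ))
  have hhigh := h.measure_Iio_eq_zero hG
  set W : ℝ≥0 → ℝ≥0∞ := fun b =>
    ∫⁻ w, ∫⁻ y, ∫⁻ z, A.alloc ![b, y, z] 0 ∂(s.bid 2 w) ∂(s.bid 1 w) ∂ν with hW
  have hae : ∀ i : Fin 3, ∀ᵐ b ∂(s.bid i 0), b = 0 := fun i =>
    (prob_compl_eq_zero_iff (measurableSet_singleton 0)).2 (hbid i)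
  -- If `w > b`, a twin bidding at least `w` beats the first bidder's bid `b`.
  have hWle : ∀ b, W b ≤ ν (Set.Iic b) := by
    intro b
    rw [← lintegral_indicator_one measurableSet_Iic]
    refine lintegral_mono_ae ?_
    filter_upwards [hhigh] with w hw
    by_cases hwb : w ≤ b
    · rw [Set.indicator_of_mem (by exact hwb), Pi.one_apply]
      refine (lintegral_mono (g := fun _ => 1) fun y => ?_).trans (by simp)
      refine (lintegral_mono (g := fun _ => 1) fun z => ?_).trans (by simp)
      exact A.coe_alloc_le_one _ _
    · rw [Set.indicator_of_notMem (by exact hwb)]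
      have hbw := not_le.1 hwb
      have hge : ∀ ρ : Measure ℝ≥0, ρ (Set.Iio w) = 0 → ∀ᵐ y ∂ρ, w ≤ y := fun ρ hρ => by
        rw [ae_iff]
        simp only [not_le]
        exact hρ
      refine le_of_eq ?_
      rcases hw with hw | hw
      · refine (lintegral_congr_ae ?_).trans lintegral_zero
        filter_upwards [hge _ hw] with y hy
        have : ∀ z, A.alloc ![b, y, z] 0 = 0 := fun z =>
          A.alloc_eq_zero_of_lt (j := 1) (hbw.trans_le hy)
        simp [this]
      · refine (lintegral_congr fun y => ?_).trans lintegral_zero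
        refine (lintegral_congr_ae ?_).trans lintegral_zero
        filter_upwards [hge _ hw] with z hz
        rw [A.alloc_eq_zero_of_lt (j := 2) (hbw.trans_le hz), ENNReal.coe_zero]
  -- When `w = 0` both twins bid `0`, and any positive bid wins.
  have hWge : ∀ b > 0, ν {0} ≤ W b := by
    intro b hb
    have h0 : ∫⁻ y, ∫⁻ z, (A.alloc ![b, y, z] 0 : ℝ≥0∞) ∂(s.bid 2 0) ∂(s.bid 1 0) = 1 := by
      have : ∀ᵐ y ∂(s.bid 1 0), ∫⁻ z, (A.alloc ![b, y, z] 0 : ℝ≥0∞) ∂(s.bid 2 0) = 1 := by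
        filter_upwards [hae 1] with y hy
        have : ∀ᵐ z ∂(s.bid 2 0), (A.alloc ![b, y, z] 0 : ℝ≥0∞) = 1 := by
          filter_upwards [hae 2] with z hz
          refine A.coe_alloc_eq_one fun j hj => ?_
          fin_cases j
          exacts [absurd rfl hj, hy ▸ hb, hz ▸ hb]
        rw [lintegral_congr_ae this]
        simp
      rw [lintegral_congr_ae this]
      simp
    calc
      ν {0} = ∫⁻ w, Set.indicator {0} 1 w ∂ν :=
        (lintegral_indicator_one (measurableSet_singleton 0)).symm
      _ ≤ W b := by
        refine lintegral_mono fun w => ?_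
        refine Set.indicator_apply_le' (fun hw => ?_) fun _ => zero_le
        rw [Set.mem_singleton_iff.1 hw, h0, Pi.one_apply]
  have hνfin : ν {0} ≠ ∞ := measure_ne_top _ _
  have hstrict : ∀ t : ℝ≥0, 0 < t → t < 1 → ∀ b > 0,
      ((t - b : ℝ≥0) : ℝ≥0∞) * W b < t * ν {0} := by
    intro t ht ht1 b hb
    have htν : 0 < t * ν {0} :=
      ENNReal.mul_pos (ENNReal.coe_ne_zero.2 ht.ne') hν
    rcases le_or_gt t b with htb | htb
    · rwa [tsub_eq_zero_of_le htb, ENNReal.coe_zero, zero_mul]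
    · have hνb0 : ν (Set.Iic b) ≠ 0 := fun h0 => hν (measure_mono_null (by simp) h0)
      -- Here `t < 1` is essential: a type at `1` could be indifferent between `0` and positive
      -- bids.
      have hlt : t - b < t * (1 - b) := by
        have hb1 := htb.trans ht1
        rw [← NNReal.coe_lt_coe, NNReal.coe_sub htb.le, NNReal.coe_mul, NNReal.coe_sub hb1.le]
        have h1 : (t : ℝ) < 1 := by exact_mod_cast ht1
        have h2 : (0 : ℝ) < b := by exact_mod_cast hb
        push_cast
        nlinarith
      calc
        _ ≤ ((t - b : ℝ≥0) : ℝ≥0∞) * ν (Set.Iic b) := mul_le_mul_right (hWle b) _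
        _ < ((t * (1 - b) : ℝ≥0) : ℝ≥0∞) * ν (Set.Iic b) :=
          (ENNReal.mul_lt_mul_iff_left hνb0 (measure_ne_top _ _)).2 (ENNReal.coe_lt_coe.2 hlt)
        _ = t * (((1 - b : ℝ≥0) : ℝ≥0∞) * ν (Set.Iic b)) := by
          rw [ENNReal.coe_mul, mul_assoc]
        _ ≤ t * ν {0} := mul_le_mul_right (hνb b) _
  have hWm : Measurable W := by
    have h1 : Measurable fun q : (ℝ≥0 × ℝ≥0) × ℝ≥0 =>
        ∫⁻ z, (A.alloc ![q.1.1, q.2, z] 0 : ℝ≥0∞) ∂(s.bid 2 q.1.2) :=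
      Measurable.lintegral_kernel_prod_right
        (κ := (s.bid 2).comap (fun q : (ℝ≥0 × ℝ≥0) × ℝ≥0 => q.1.2) (by fun_prop))
        (f := fun q z => (A.alloc ![q.1.1, q.2, z] 0 : ℝ≥0∞))
        (measurable_coe_alloc_vec A 0 (by fun_prop) (by fun_prop) (by fun_prop))
    have h2 : Measurable fun q : ℝ≥0 × ℝ≥0 =>
        ∫⁻ y, ∫⁻ z, (A.alloc ![q.1, y, z] 0 : ℝ≥0∞) ∂(s.bid 2 q.2) ∂(s.bid 1 q.2) :=
      Measurable.lintegral_kernel_prod_right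
        (κ := (s.bid 1).comap (Prod.snd : ℝ≥0 × ℝ≥0 → ℝ≥0) measurable_snd)
        (f := fun q y => ∫⁻ z, (A.alloc ![q.1, y, z] 0 : ℝ≥0∞) ∂(s.bid 2 q.2)) h1
    exact h2.lintegral_prod_right'
  have hkey : ∀ᵐ t ∂μ, ∫⁻ b, t * A.interimWin (pairedLaw μ ν) s 0 t b ∂(s.bid 0 t) ≤ ν {0} := by
    have e0 := h.exists_utility 0
    rw [map_eval_zero_pairedLaw] at e0
    filter_upwards [e0, interimWin_zero_pairedLaw μ ν A s, hμ1] with t ⟨M, _, hdev, hle⟩ hWt ht1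
    have hWt' : ∀ b, A.interimWin (pairedLaw μ ν) s 0 t b = W b := hWt
    simp only [hWt'] at hdev hle ⊢
    rcases eq_or_lt_of_le (zero_le : 0 ≤ t) with rfl | ht
    · simp
    -- Positive bids tending to `0` secure `t * ν {0}`, even if the bid `0` loses ties.
    have hM : (t : ℝ≥0∞) * ν {0} ≤ M := by
      have := sub_mul_le_of_forall_lt (v := t) (b := 0) hνfin fun b hb =>
        (mul_le_mul_right (hWge b hb) _).trans (hdev b)
      rwa [tsub_zero] at this
    have hpt : ∀ b, ((t - b : ℝ≥0) : ℝ≥0∞) * W b ≤ t * ν {0} := fun b => by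
      rcases eq_or_lt_of_le (zero_le : 0 ≤ b) with rfl | hb
      · rw [tsub_zero]
        refine mul_le_mul_right ((hWle 0).trans (measure_mono ?_)) _
        intro x hx
        exact le_antisymm hx zero_le
      · exact (hstrict t ht ht1 b hb).le
    have htfin : (t : ℝ≥0∞) * ν {0} ≠ ∞ := ENNReal.mul_ne_top ENNReal.coe_ne_top hνfin
    -- No bid earns more than `t * ν {0}`, so almost every bid played earns exactly this, which
    -- excludes positive bids.
    have hae := ae_eq_of_ae_le_of_lintegral_le (μ := s.bid 0 t) (g := fun _ => (t : ℝ≥0∞) * ν {0})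
      (.of_forall hpt)
      (ne_top_of_le_ne_top htfin ((lintegral_mono hpt).trans (by simp)))
      aemeasurable_const (by simpa using hM.trans hle)
    have hle' : ∫⁻ b, t * W b ∂(s.bid 0 t) ≤ ∫⁻ _, ν {0} ∂(s.bid 0 t) := by
      refine lintegral_mono_ae ?_
      filter_upwards [hae] with b hb
      have hb0 : b = 0 := by
        by_contra hne
        exact (hstrict t ht ht1 b (pos_iff_ne_zero.2 hne)).ne hb
      subst hb0
      rw [tsub_zero] at hb
      rw [hb]
      exact (mul_le_mul_left (ENNReal.coe_le_one_iff.2 ht1.le) _).trans (one_mul _).le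
    simpa using hle'
  have hfirst : ∫⁻ w, ∫⁻ β, (w 0 : ℝ≥0∞) * A.alloc β 0 ∂(s.bidLaw w) ∂(pairedLaw μ ν)
      ≤ ν {0} := by
    rw [← A.lintegral_lintegral_mul_interimWin (pairedLaw μ ν) s 0 (g := fun v _ => v)
      measurable_fst.coe_nnreal_ennreal, map_eval_zero_pairedLaw]
    exact (lintegral_mono_ae hkey).trans (by simp)
  have hsecond : ∫⁻ w, (w 1 : ℝ≥0∞) ∂(pairedLaw μ ν) = ∫⁻ w, w ∂ν := by
    rw [lintegral_pairedLaw μ ν (measurable_pi_apply 1).coe_nnreal_ennreal]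
    simp
  have hmeas : Measurable fun w : Fin 3 → ℝ≥0 =>
      ∫⁻ β, (w 0 : ℝ≥0∞) * A.alloc β 0 ∂(s.bidLaw w) :=
    s.measurable_lintegral_bidLaw (g := fun w => w) measurable_id
      (f := fun w β => (w 0 : ℝ≥0∞) * A.alloc β 0)
      ((measurable_pi_apply 0).comp measurable_fst |>.coe_nnreal_ennreal.mul
        ((A.measurable_coe_alloc 0).comp measurable_snd))
  -- The first bidder's share is kept; the twins' joint share is bounded as if one of them always
  -- won.
  refine le_trans ?_ (add_le_add hfirst hsecond.le)
  rw [← lintegral_add_left hmeas]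
  refine lintegral_mono_ae ?_
  have hV12 : ∀ᵐ w ∂(pairedLaw μ ν), w 2 = w 1 := by
    refine (ae_map_iff measurable_paired.aemeasurable
      (measurableSet_eq_fun (measurable_pi_apply 2) (measurable_pi_apply 1))).2 ?_
    exact .of_forall fun p => rfl
  filter_upwards [hV12] with w hw
  have hm0 : Measurable fun β : Fin 3 → ℝ≥0 => (w 0 : ℝ≥0∞) * A.alloc β 0 :=
    (A.measurable_coe_alloc 0).const_mul _
  have hc : (w 1 : ℝ≥0∞) = ∫⁻ _, (w 1 : ℝ≥0∞) ∂(s.bidLaw w) := by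
    rw [lintegral_const, measure_univ, mul_one]
  rw [hc, ← lintegral_add_left hm0]
  refine lintegral_mono fun β => ?_
  simp only [Fin.sum_univ_three, hw]
  rw [add_assoc, mul_comm, ← add_mul]
  refine add_le_add_right ((mul_le_mul_left (?_ : _ ≤ (1 : ℝ≥0∞)) _).trans (one_mul _).le) _
  rw [← A.sum_coe_alloc β, Fin.sum_univ_three, add_assoc]
  exact le_add_self

end

end FirstPriceAuction

/-! ### The concrete value laws -/

/-- The law on `[0, 1 - 1/e]` with distribution function `b ↦ 1 / (e (1 - b))`, against which a
bidder of value `1` is indifferent between all bids. -/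
noncomputable def equalRevenueLaw : Measure ℝ≥0 :=
  (volume.restrict (Set.Ioc (0 : ℝ) 1)).map fun u => (1 - 1 / Real.exp 1 / u).toNNReal

theorem measurable_equalRevenue :
    Measurable fun u : ℝ => (1 - 1 / Real.exp 1 / u).toNNReal := by
  fun_prop

instance : IsProbabilityMeasure equalRevenueLaw := by
  have : IsProbabilityMeasure (volume.restrict (Set.Ioc (0 : ℝ) 1)) :=
    ⟨by simp⟩
  exact Measure.isProbabilityMeasure_map measurable_equalRevenue.aemeasurable

theorem equalRevenueLaw_singleton_zero :
    equalRevenueLaw {0} = ENNReal.ofReal (1 / Real.exp 1) := by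
  have hc : 0 < 1 / Real.exp 1 := by positivity
  rw [equalRevenueLaw, Measure.map_apply measurable_equalRevenue (measurableSet_singleton 0),
    Measure.restrict_apply (measurable_equalRevenue (measurableSet_singleton 0))]
  have : (fun u : ℝ => (1 - 1 / Real.exp 1 / u).toNNReal) ⁻¹' {0} ∩ Set.Ioc 0 1
      = Set.Ioc 0 (1 / Real.exp 1) := by
    ext u
    simp only [Set.mem_inter_iff, Set.mem_preimage, Set.mem_singleton_iff, Real.toNNReal_eq_zero,
      Set.mem_Ioc, sub_nonpos]
    constructor
    · rintro ⟨h, h0, -⟩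
      exact ⟨h0, (one_le_div h0).1 h⟩
    · rintro ⟨h0, h⟩
      exact ⟨(one_le_div h0).2 h, h0, h.trans one_div_exp_one_lt_one.le⟩
  rw [this, Real.volume_Ioc, sub_zero]

/-- With `u` uniform on `(0, 1]`, the value is at most `b < 1` only if `u ≤ 1 / (e (1 - b))`; the
factor `1 - b` cancels. -/
theorem sub_mul_equalRevenueLaw_Iic_le (b : ℝ≥0) :
    ((1 - b : ℝ≥0) : ℝ≥0∞) * equalRevenueLaw (Set.Iic b) ≤ equalRevenueLaw {0} := by
  rcases le_or_gt 1 b with hb | hb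
  · simp [tsub_eq_zero_of_le hb]
  have hb' : 0 < 1 - (b : ℝ) := sub_pos.2 (by exact_mod_cast hb)
  have hle : equalRevenueLaw (Set.Iic b) ≤ ENNReal.ofReal (1 / Real.exp 1 / (1 - b)) := by
    rw [equalRevenueLaw, Measure.map_apply measurable_equalRevenue measurableSet_Iic,
      Measure.restrict_apply (measurable_equalRevenue measurableSet_Iic),
      ← sub_zero (1 / Real.exp 1 / (1 - (b : ℝ))), ← Real.volume_Ioc]
    refine measure_mono fun u hu => ?_
    obtain ⟨h, h0, -⟩ := hu
    refine ⟨h0, ?_⟩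
    have h' := Real.toNNReal_le_iff_le_coe.1 (Set.mem_Iic.1 h)
    rw [le_div_iff₀ hb']
    have : 1 - (b : ℝ) ≤ 1 / Real.exp 1 / u := by linarith
    rw [le_div_iff₀ h0] at this
    linarith
  rw [equalRevenueLaw_singleton_zero]
  refine (mul_le_mul_right hle _).trans (le_of_eq ?_)
  have : ((1 - b : ℝ≥0) : ℝ≥0∞) = ENNReal.ofReal (1 - b) := by
    rw [NNReal.sub_def]
    rfl
  rw [this, ← ENNReal.ofReal_mul hb'.le, mul_div_cancel₀ _ hb'.ne']

/-- With `c = 1/e`, the mean is the integral of `1 - c / u` over `(c, 1]`, namely `1 - c + c log c`,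
and `log c = -1`. -/
theorem lintegral_equalRevenueLaw :
    ∫⁻ w, w ∂equalRevenueLaw = ENNReal.ofReal (1 - 2 * (1 / Real.exp 1)) := by
  set c := 1 / Real.exp 1 with hc
  have hc0 : 0 < c := by positivity
  have hc1 : c ≤ 1 := one_div_exp_one_lt_one.le
  have hm : Measurable fun u : ℝ => (1 - c / u).toNNReal := measurable_equalRevenue
  rw [equalRevenueLaw, lintegral_map measurable_coe_nnreal_ennreal hm,
    ← Set.Ioc_union_Ioc_eq_Ioc hc0.le hc1, lintegral_union measurableSet_Ioc
      (Set.Ioc_disjoint_Ioc_of_le le_rfl)]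
  have h1 : ∫⁻ u in Set.Ioc 0 c, ((1 - c / u).toNNReal : ℝ≥0∞) = 0 := by
    rw [← lintegral_zero (μ := volume.restrict (Set.Ioc 0 c))]
    refine setLIntegral_congr_fun measurableSet_Ioc fun u (hu : u ∈ Set.Ioc 0 c) => ?_
    have : 1 - c / u ≤ 0 := sub_nonpos.2 ((one_le_div hu.1).2 hu.2)
    simp [Real.toNNReal_of_nonpos this]
  have hdiv : ContinuousOn (fun u : ℝ => c / u) (Set.Icc c 1) :=
    continuousOn_const.div continuousOn_id fun u hu => (hc0.trans_le hu.1).ne'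
  have hcont : ContinuousOn (fun u : ℝ => 1 - c / u) (Set.Icc c 1) := continuousOn_const.sub hdiv
  have h2 : ∫⁻ u in Set.Ioc c 1, ((1 - c / u).toNNReal : ℝ≥0∞)
      = ENNReal.ofReal (∫ u in Set.Ioc c 1, (1 - c / u)) := by
    rw [ofReal_integral_eq_lintegral_ofReal
      (hcont.integrableOn_Icc.mono_set Set.Ioc_subset_Icc_self)]
    · rfl
    · refine (ae_restrict_iff' measurableSet_Ioc).2 (.of_forall fun u hu => ?_)
      exact sub_nonneg.2 ((div_le_one (hc0.trans hu.1)).2 hu.1.le)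
  have h3 : ∫ u in Set.Ioc c 1, (1 - c / u) = 1 - 2 * c := by
    rw [← intervalIntegral.integral_of_le hc1, intervalIntegral.integral_sub]
    · simp only [div_eq_mul_inv c]
      rw [intervalIntegral.integral_const_mul, integral_inv_of_pos hc0 one_pos, hc, one_div_one_div,
        Real.log_exp]
      simp
      ring
    · simp
    · exact (hdiv.mono (Set.uIcc_of_le hc1).subset).intervalIntegrable
  rw [h1, h2, h3, zero_add]

/-- The law of a random variable with values `q`, with probability `q`, and `0`. -/
noncomputable def twoPointLaw (q : ℝ≥0) : Measure ℝ≥0 :=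
  (1 - q) • Measure.dirac 0 + q • Measure.dirac q

theorem isProbabilityMeasure_twoPointLaw {q : ℝ≥0} (hq : q ≤ 1) :
    IsProbabilityMeasure (twoPointLaw q) := by
  constructor
  rw [twoPointLaw, Measure.add_apply, Measure.coe_nnreal_smul_apply,
    Measure.coe_nnreal_smul_apply, measure_univ, measure_univ, mul_one, mul_one,
    ← ENNReal.coe_add, tsub_add_cancel_of_le hq, ENNReal.coe_one]

theorem twoPointLaw_singleton_zero_ne_zero {q : ℝ≥0} (hq : q < 1) : twoPointLaw q {0} ≠ 0 := by
  have : (1 - q : ℝ≥0) ≠ 0 := (tsub_pos_of_lt hq).ne'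
  rw [twoPointLaw, Measure.add_apply, Measure.coe_nnreal_smul_apply,
    Measure.dirac_apply_of_mem (Set.mem_singleton 0), mul_one]
  exact fun h0 => this (ENNReal.coe_eq_zero.1 (add_eq_zero.1 h0).1)

theorem ae_twoPointLaw_lt_one {q : ℝ≥0} (hq : q < 1) : ∀ᵐ t ∂(twoPointLaw q), t < 1 := by
  rw [twoPointLaw, ae_add_measure_iff]
  constructor <;> refine Measure.ae_smul_measure ?_ _ <;>
    rw [ae_dirac_iff measurableSet_Iio]
  exacts [one_pos, hq]

theorem lintegral_twoPointLaw (q : ℝ≥0) : ∫⁻ t, t ∂(twoPointLaw q) = (q ^ 2 : ℝ≥0) := by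
  rw [twoPointLaw, lintegral_add_measure, lintegral_smul_measure, lintegral_smul_measure,
    lintegral_dirac, lintegral_dirac, ENNReal.smul_def, ENNReal.smul_def]
  simp [sq]

/-! ### An equilibrium of the instance and its optimal welfare -/

namespace FirstPriceAuction

/-- The first-price auction with three bidders in which ties are broken in favour of the bidder
with the lowest index. -/
noncomputable def lowestIndexAuction : FirstPriceAuction 3 where
  alloc b := if b 1 ≤ b 0 ∧ b 2 ≤ b 0 then Pi.single 0 1
    else if b 2 ≤ b 1 then Pi.single 1 1 else Pi.single 2 1
  measurable_alloc i := by
    have h : ∀ j k : Fin 3, MeasurableSet {b : Fin 3 → ℝ≥0 | b j ≤ b k} := fun j k =>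
      measurableSet_le (measurable_pi_apply j) (measurable_pi_apply k)
    simp only [ite_apply]
    exact Measurable.ite ((h 1 0).inter (h 2 0)) measurable_const
      (Measurable.ite (h 2 1) measurable_const measurable_const)
  sum_alloc b := by
    split_ifs <;> simp
  highest_of_alloc_ne_zero b i hi j := by
    split_ifs at hi with h1 h2
    all_goals
      fin_cases i <;> simp at hi
      fin_cases j
    · exact le_rfl
    · exact h1.1
    · exact h1.2
    · by_contra h
      simp only [not_le] at h
      exact h1 ⟨h.le, h2.trans h.le⟩
    · exact le_rfl
    · exact h2
    · by_contra h
      simp only [not_le] at h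
      exact h1 ⟨(not_le.1 h2).le.trans h.le, h.le⟩
    · exact (not_le.1 h2).le
    · exact le_rfl

theorem lowestIndexAuction_alloc_zero (b w : ℝ≥0) :
    (lowestIndexAuction.alloc ![b, w, w] 0 : ℝ≥0∞) = (Set.Iic b).indicator 1 w := by
  by_cases h : w ≤ b
  · simp [lowestIndexAuction, h]
  · simp [lowestIndexAuction, h]

/-- The strategy profile of three bidders in which the first one bids `0` and the others bid their
values. -/
noncomputable def passiveFirstBidder : StrategyProfile 3 where
  bid := ![Kernel.const ℝ≥0 (Measure.dirac 0), Kernel.id, Kernel.id]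
  isMarkovKernel_bid i := by
    fin_cases i
    · exact inferInstanceAs (IsMarkovKernel (Kernel.const ℝ≥0 (Measure.dirac (0 : ℝ≥0))))
    · exact inferInstanceAs (IsMarkovKernel (Kernel.id : Kernel ℝ≥0 ℝ≥0))
    · exact inferInstanceAs (IsMarkovKernel (Kernel.id : Kernel ℝ≥0 ℝ≥0))

theorem passiveFirstBidder_bid_one (v : ℝ≥0) :
    passiveFirstBidder.bid 1 v = Measure.dirac v := Kernel.id_apply v

theorem passiveFirstBidder_bid_two (v : ℝ≥0) :
    passiveFirstBidder.bid 2 v = Measure.dirac v := Kernel.id_apply v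

/-- Breaking ties for the first bidder makes her bid `0` win with probability exactly `ν {0}`, so
her supremum is attained. A twin facing a bid equal to their common value cannot earn a profit. -/
theorem isBayesNashEquilibrium_passiveFirstBidder (μ ν : Measure ℝ≥0) [IsProbabilityMeasure μ]
    [IsProbabilityMeasure ν] (hμ1 : ∀ᵐ t ∂μ, t < 1)
    (hνb : ∀ b : ℝ≥0, ((1 - b : ℝ≥0) : ℝ≥0∞) * ν (Set.Iic b) ≤ ν {0}) :
    lowestIndexAuction.IsBayesNashEquilibrium (pairedLaw μ ν) passiveFirstBidder := by
  set A := lowestIndexAuction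
  set s := passiveFirstBidder
  have hdirac : ∀ (f : ℝ≥0 → ℝ) (a : ℝ≥0), (∀ b, f b ≤ f a) →
      Integrable f (Measure.dirac a) ∧ ∀ b, f b ≤ ∫ b, f b ∂(Measure.dirac a) := fun f a hf =>
    ⟨integrable_dirac (by simp), fun b => by rw [integral_dirac]; exact hf b⟩
  have hcomp : ∀ (i : Fin 3) (w : ℝ≥0),
      (∀ b < w, A.interimWin (pairedLaw μ ν) s i w b = 0) →
      ∀ b, A.interimUtility (pairedLaw μ ν) s i w b ≤ A.interimUtility (pairedLaw μ ν) s i w w := by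
    intro i w hw b
    simp only [interimUtility, sub_self, zero_mul]
    rcases lt_or_ge b w with hb | hb
    · simp [hw b hb]
    · exact mul_nonpos_of_nonpos_of_nonneg (sub_nonpos.2 (by exact_mod_cast hb))
        ENNReal.toReal_nonneg
  intro i
  fin_cases i
  · change ∀ᵐ v ∂((pairedLaw μ ν).map fun w => w 0), _
    rw [map_eval_zero_pairedLaw]
    filter_upwards [interimWin_zero_pairedLaw μ ν A s, hμ1] with t hW ht1
    refine hdirac _ 0 fun b => ?_
    have hWb : ∀ b, A.interimWin (pairedLaw μ ν) s 0 t b = ν (Set.Iic b) := fun b => by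
      rw [hW, ← lintegral_indicator_one measurableSet_Iic]
      refine lintegral_congr fun w => ?_
      rw [passiveFirstBidder_bid_one, passiveFirstBidder_bid_two, lintegral_dirac, lintegral_dirac]
      exact lowestIndexAuction_alloc_zero b w
    change A.interimUtility (pairedLaw μ ν) s 0 t b ≤ A.interimUtility (pairedLaw μ ν) s 0 t 0
    rw [interimUtility, interimUtility, hWb, hWb, NNReal.coe_zero, sub_zero]
    have hIic : Set.Iic (0 : ℝ≥0) = {0} := by
      ext x
      simp
    rw [hIic]
    rcases le_or_gt t b with htb | htb
    · exact (mul_nonpos_of_nonpos_of_nonneg (sub_nonpos.2 (by exact_mod_cast htb))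
        ENNReal.toReal_nonneg).trans (mul_nonneg t.coe_nonneg ENNReal.toReal_nonneg)
    · have hreal := ENNReal.toReal_mono (measure_ne_top ν {0}) (hνb b)
      rw [ENNReal.toReal_mul, ENNReal.coe_toReal, NNReal.coe_sub (htb.trans ht1).le,
        NNReal.coe_one] at hreal
      have h1 : (t : ℝ) < 1 := by exact_mod_cast ht1
      calc
        ((t : ℝ) - b) * (ν (Set.Iic b)).toReal
            ≤ t * (1 - b) * (ν (Set.Iic b)).toReal := by
          refine mul_le_mul_of_nonneg_right ?_ ENNReal.toReal_nonneg
          nlinarith [b.coe_nonneg]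
        _ = t * ((1 - b) * (ν (Set.Iic b)).toReal) := mul_assoc _ _ _
        _ ≤ t * (ν {0}).toReal := mul_le_mul_of_nonneg_left hreal t.coe_nonneg
  · change ∀ᵐ v ∂((pairedLaw μ ν).map fun w => w 1), _
    rw [map_eval_one_pairedLaw]
    filter_upwards [interimWin_one_pairedLaw μ ν A s] with w hW
    change Integrable (fun b => A.interimUtility (pairedLaw μ ν) s 1 w b) (s.bid 1 w) ∧
      ∀ b', A.interimUtility (pairedLaw μ ν) s 1 w b' ≤ ∫ b, _ ∂(s.bid 1 w)
    rw [passiveFirstBidder_bid_one]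
    refine hdirac _ w (hcomp 1 w fun b hb => ?_)
    rw [hW, passiveFirstBidder_bid_two, lintegral_dirac]
    refine (lintegral_congr fun x => ?_).trans lintegral_zero
    rw [A.alloc_eq_zero_of_lt (i := 1) (j := 2) hb, ENNReal.coe_zero]
  · change ∀ᵐ v ∂((pairedLaw μ ν).map fun w => w 2), _
    rw [map_eval_two_pairedLaw]
    filter_upwards [interimWin_two_pairedLaw μ ν A s] with w hW
    change Integrable (fun b => A.interimUtility (pairedLaw μ ν) s 2 w b) (s.bid 2 w) ∧
      ∀ b', A.interimUtility (pairedLaw μ ν) s 2 w b' ≤ ∫ b, _ ∂(s.bid 2 w)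
    rw [passiveFirstBidder_bid_two]
    refine hdirac _ w (hcomp 2 w fun b hb => ?_)
    rw [hW, passiveFirstBidder_bid_one, lintegral_dirac]
    refine (lintegral_congr fun x => ?_).trans lintegral_zero
    rw [A.alloc_eq_zero_of_lt (i := 2) (j := 1) hb, ENNReal.coe_zero]

theorem lintegral_le_optWelfare_pairedLaw (μ ν : Measure ℝ≥0) [IsProbabilityMeasure ν] :
    ∫⁻ t, t ∂μ ≤ optWelfare (pairedLaw μ ν) := by
  rw [optWelfare, lintegral_pairedLaw μ ν measurable_sup_univ.coe_nnreal_ennreal]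
  refine lintegral_mono fun t => ?_
  refine le_trans (le_of_eq (by simp : (t : ℝ≥0∞) = ∫⁻ _, (t : ℝ≥0∞) ∂ν))
    (lintegral_mono fun w => ENNReal.coe_le_coe.2 ?_)
  exact Finset.le_sup (f := ![t, w, w]) (Finset.mem_univ 0)

theorem optWelfare_pairedLaw_le (μ ν : Measure ℝ≥0) [IsProbabilityMeasure μ]
    [IsProbabilityMeasure ν] :
    optWelfare (pairedLaw μ ν) ≤ ∫⁻ t, t ∂μ + ∫⁻ w, w ∂ν := by
  rw [optWelfare, lintegral_pairedLaw μ ν measurable_sup_univ.coe_nnreal_ennreal]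
  calc
    _ ≤ ∫⁻ t, ∫⁻ w, ((t : ℝ≥0∞) + w) ∂ν ∂μ := by
      refine lintegral_mono fun t => lintegral_mono fun w => ?_
      rw [← ENNReal.coe_add, ENNReal.coe_le_coe]
      refine Finset.sup_le fun i _ => ?_
      fin_cases i
      exacts [le_self_add, le_add_self, le_add_self]
    _ = _ := by
      simp [lintegral_add_left measurable_const,
        lintegral_add_left measurable_coe_nnreal_ennreal]

/-- For every `q < 1` there is an instance that has an equilibrium, all of whose equilibria, for
any tie-breaking rule, have at most a `(1 - 1/e) / q²` fraction of the optimal welfare. -/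
theorem exists_inefficient_instance {q : ℝ≥0} (hq0 : 0 < q) (hq1 : q < 1) :
    ∃ V : Measure (Fin 3 → ℝ≥0), ∃ _ : IsProbabilityMeasure V,
      optWelfare V ≠ 0 ∧ optWelfare V ≠ ∞ ∧
      (∃ (A : FirstPriceAuction 3) (s : StrategyProfile 3), A.IsBayesNashEquilibrium V s) ∧
      ∀ (A : FirstPriceAuction 3) (s : StrategyProfile 3), A.IsBayesNashEquilibrium V s →
        A.welfare V s / optWelfare V
          ≤ ENNReal.ofReal (1 - 1 / Real.exp 1) / (q ^ 2 : ℝ≥0) := by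
  have hμ := isProbabilityMeasure_twoPointLaw hq1.le
  have hlow : ((q ^ 2 : ℝ≥0) : ℝ≥0∞) ≤ optWelfare (pairedLaw (twoPointLaw q) equalRevenueLaw) := by
    rw [← lintegral_twoPointLaw]
    exact lintegral_le_optWelfare_pairedLaw _ _
  have hq2 : ((q ^ 2 : ℝ≥0) : ℝ≥0∞) ≠ 0 := ENNReal.coe_ne_zero.2 (pow_pos hq0 2).ne'
  refine ⟨pairedLaw (twoPointLaw q) equalRevenueLaw, inferInstance, ?_, ?_,
    ⟨_, _, isBayesNashEquilibrium_passiveFirstBidder _ _ (ae_twoPointLaw_lt_one hq1)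
      sub_mul_equalRevenueLaw_Iic_le⟩, fun A s h => ENNReal.div_le_div ?_ hlow⟩
  · intro h0
    exact hq2 (le_antisymm (h0 ▸ hlow) zero_le)
  · refine ne_top_of_le_ne_top ?_ (optWelfare_pairedLaw_le _ _)
    rw [lintegral_twoPointLaw, lintegral_equalRevenueLaw]
    exact ENNReal.add_ne_top.2 ⟨ENNReal.coe_ne_top, ENNReal.ofReal_ne_top⟩
  · refine (h.welfare_pairedLaw_le (twoPointLaw_singleton_zero_ne_zero hq1)
      (ae_twoPointLaw_lt_one hq1) ?_ sub_mul_equalRevenueLaw_Iic_le).trans (le_of_eq ?_)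
    · rw [equalRevenueLaw_singleton_zero]
      exact (ENNReal.ofReal_pos.2 (by positivity)).ne'
    · have h2 : 2 * (1 / Real.exp 1) ≤ 1 := by
        rw [mul_one_div, div_le_one (Real.exp_pos 1)]
        linarith [Real.add_one_le_exp 1]
      -- The atom and the mean add up: `1/e + (1 - 2/e) = 1 - 1/e`.
      rw [equalRevenueLaw_singleton_zero, lintegral_equalRevenueLaw,
        ← ENNReal.ofReal_add (by positivity) (by linarith)]
      congr 1
      ring

/-! ### Letting `q` tend to `1` and conclusion -/

theorem le_of_forall_le_div_sq {x : ℝ≥0∞} {r : ℝ}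
    (h : ∀ q : ℝ≥0, 0 < q → q < 1 → x ≤ ENNReal.ofReal r / (q ^ 2 : ℝ≥0)) :
    x ≤ ENNReal.ofReal r := by
  have hcont : ContinuousAt (fun q : ℝ≥0 => ((r.toNNReal / q ^ 2 : ℝ≥0) : ℝ≥0∞)) 1 :=
    ENNReal.continuous_coe.continuousAt.comp
      (continuousAt_const.div (continuousAt_id.pow 2) (by simp))
  have hlim : Filter.Tendsto (fun q : ℝ≥0 => ((r.toNNReal / q ^ 2 : ℝ≥0) : ℝ≥0∞))
      (nhdsWithin 1 (Set.Iio 1)) (nhds (ENNReal.ofReal r)) := by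
    have := hcont.tendsto.mono_left (nhdsWithin_le_nhds (s := Set.Iio 1))
    rwa [one_pow, div_one] at this
  have hne : (nhdsWithin (1 : ℝ≥0) (Set.Iio 1)).NeBot := nhdsLT_neBot_of_exists_lt ⟨0, one_pos⟩
  refine ge_of_tendsto hlim ?_
  filter_upwards [self_mem_nhdsWithin, nhdsWithin_le_nhds (lt_mem_nhds (one_pos : (0 : ℝ≥0) < 1))]
    with q hq1 hq0
  refine (h q hq0 hq1).trans (le_of_eq ?_)
  rw [ENNReal.coe_div (pow_pos hq0 2).ne']
  rfl

theorem IsBayesNashEquilibrium.le_welfare_div_optWelfare {n : ℕ} {A : FirstPriceAuction n}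
    {V : Measure (Fin n → ℝ≥0)} [IsProbabilityMeasure V] {s : StrategyProfile n}
    (h : A.IsBayesNashEquilibrium V s) (h0 : optWelfare V ≠ 0) (hfin : optWelfare V ≠ ∞) :
    ENNReal.ofReal (1 - 1 / Real.exp 1) ≤ A.welfare V s / optWelfare V :=
  (ENNReal.le_div_iff_mul_le (Or.inl h0) (Or.inl hfin)).2 h.mul_optWelfare_le_welfare

end FirstPriceAuction

theorem mainTheorem2 :
    FirstPriceAuction.priceOfStability = ENNReal.ofReal (1 - 1 / Real.exp 1) ∧
    FirstPriceAuction.priceOfStabilityFreeTies = ENNReal.ofReal (1 - 1 / Real.exp 1) := by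
  refine ⟨le_antisymm ?_ ?_, le_antisymm ?_ ?_⟩
  · refine FirstPriceAuction.le_of_forall_le_div_sq fun q hq0 hq1 => ?_
    obtain ⟨V, hV, h0, hfin, ⟨A, s, hs⟩, hle⟩ :=
      FirstPriceAuction.exists_inefficient_instance hq0 hq1
    exact iInf_le_of_le 3 <| iInf_le_of_le V <| iInf_le_of_le hV <| iInf_le_of_le h0 <|
      iInf_le_of_le hfin <| iInf_le_of_le A <| iInf_le_of_le ⟨s, hs⟩ <| iSup₂_le (hle A)
  · refine le_iInf fun n => le_iInf fun V => le_iInf fun hV => le_iInf fun h0 => le_iInf fun hfin =>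
      le_iInf fun A => le_iInf fun hA => ?_
    obtain ⟨s, hs⟩ := hA
    exact le_iSup₂_of_le s hs (hs.le_welfare_div_optWelfare h0 hfin)
  · refine FirstPriceAuction.le_of_forall_le_div_sq fun q hq0 hq1 => ?_
    obtain ⟨V, hV, h0, hfin, hex, hle⟩ := FirstPriceAuction.exists_inefficient_instance hq0 hq1
    exact iInf_le_of_le 3 <| iInf_le_of_le V <| iInf_le_of_le hV <| iInf_le_of_le h0 <|
      iInf_le_of_le hfin <| iInf_le_of_le hex <| iSup_le fun A => iSup₂_le (hle A)
  · refine le_iInf fun n => le_iInf fun V => le_iInf fun hV => le_iInf fun h0 => le_iInf fun hfin =>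
      le_iInf fun hex => ?_
    obtain ⟨A, s, hs⟩ := hex
    exact le_iSup_of_le A (le_iSup₂_of_le s hs (hs.le_welfare_div_optWelfare h0 hfin))
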